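/- Let $\Omega$ be a probability distribution on $\mathbb{R}$ with finite sixth moment, let $m_k = E_{x\sim\Omega}[x^k]$, and suppose $m_1 = 0$ and $m_2 = 1$ (no condition on $m_3$). For $n \ge 0$ let $f_6^*(n) = E[\det(M)^6]$, where $M$ is an $n\times n$ matrix whose entries are drawn independently from $\Omega$ (this expectation is finite), and let $F_6^*(t) = \sum_{n=0}^\infty \frac{t^n}{(n!)^2} f_6^*(n)$. Then, as formal power series in $t$, \[ F_6^*(t) = \left(1+m_3^2 t\right)^{10}\, \frac{e^{t\left(m_6-10m_3^2-15m_4+30\right)}}{48\left(1+3t-m_4t\right)^{15}} \sum_{i=0}^{\infty} \frac{(1+i)(2+i)(4+i)!\,t^i}{\left(1+3t-m_4t\right)^{3i}}. \] Equivalently, \[ F_6^*(t) = \left(1+m_3^2t\right)^{10} e^{-10m_3^2t}\, F_6(t), \qquad F_6(t) = \sum_{n=0}^\infty \frac{t^n}{(n!)^2} f_6(n). \] Here $f_6(n) = \sum_T \operatorname{sgn}(T)\,w(T)$, where $T$ runs over the $6\times n$ tables whose rows are permutations of $\{1,\dots,n\}$ and in which each column contains each number an even number of times, $\operatorname{sgn}(T)$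 is the product of the signs of the rows of $T$, and $w(T)$ is the product, over all columns of $T$ and all $v\in\{1,\dots,n\}$, of $m_{c}$ with $c$ the number of times $v$ occurs in the column. (When $m_3=0$ this $f_6(n)$ is the sixth moment of the determinant itself.) -/

import Mathlib

open MeasureTheory ProbabilityTheory PowerSeries

noncomputable section

namespace SixthMoment

/-- The distribution of an `n × n` real matrix (as a family of rows) whose entries are drawn
independently from `μ`. -/
def iidMatrix (μ : Measure ℝ) (n : ℕ) : Measure (Fin n → Fin n → ℝ) :=
  Measure.pi fun _ => Measure.pi fun _ => μ

/-- The `k`-th moment of the determinant of a random `n × n` matrix with independent entries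
distributed according to `μ`. -/
def detMoment (μ : Measure ℝ) (k n : ℕ) : ℝ :=
  ∫ M, (Matrix.of M).det ^ k ∂(iidMatrix μ n)

/-- The formal power series `∑ₙ a(n) tⁿ / (n!)²`. -/
def genFun (a : ℕ → ℝ) : ℝ⟦X⟧ :=
  PowerSeries.mk fun n => a n / (n.factorial : ℝ) ^ 2

/-- A `k × n` table whose rows are permutations of an `n`-element set. -/
abbrev Table (k n : ℕ) : Type := Fin k → Equiv.Perm (Fin n)

/-- The number of times the number `v` appears in the column `p` of the table `T`. -/
def Table.count {k n : ℕ} (T : Table k n) (p v : Fin n) : ℕ :=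
  (Finset.univ.filter fun q : Fin k => T q p = v).card

/-- A table is even if each column contains each number an even number of times. -/
def Table.IsEven {k n : ℕ} (T : Table k n) : Prop :=
  ∀ p v : Fin n, Even (T.count p v)

/-- The sign of a table: the product of the signs of its rows. -/
def Table.sgn {k n : ℕ} (T : Table k n) : ℝ :=
  ∏ q : Fin k, ((Equiv.Perm.sign (T q) : ℤ) : ℝ)

/-- The weight of a table with respect to a moment sequence `m`: the product over all columns of
`∏ᵥ m (number of times v appears in the column)`. -/
def Table.weight {k n : ℕ} (m : ℕ → ℝ) (T : Table k n) : ℝ :=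
  ∏ p : Fin n, ∏ v : Fin n, m (T.count p v)

open Classical in
/-- The sum of the signed weights of all even `k × n` tables. -/
def evenTableSum (m : ℕ → ℝ) (k n : ℕ) : ℝ :=
  ∑ T : Table k n with T.IsEven, T.sgn * T.weight m

/-- The `i`-th term `(1+i)(2+i)(4+i)! tⁱ / (1 + 3t - m₄ t)³ⁱ`. -/
def summand (m₄ : ℝ) (i : ℕ) : ℝ⟦X⟧ :=
  C ((1 + i) * (2 + i) * ((4 + i).factorial : ℝ)) * X ^ i *
    ((1 + 3 * X - C m₄ * X)⁻¹) ^ (3 * i)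

/-- The formal sum `∑ᵢ summand m₄ i`, computed coefficient by coefficient: only the terms with
`i ≤ n` contribute to the coefficient of `tⁿ` (see `coeff_summand_eq_zero` and `hasSum_summand`). -/
def summandSum (m₄ : ℝ) : ℝ⟦X⟧ :=
  PowerSeries.mk fun n => ∑ i ∈ Finset.range (n + 1), coeff n (summand m₄ i)

theorem coeff_summand_eq_zero (m₄ : ℝ) {n i : ℕ} (h : n < i) : coeff n (summand m₄ i) = 0 := by
  have : summand m₄ i = X ^ i * (C ((1 + i) * (2 + i) * ((4 + i).factorial : ℝ)) *
      ((1 + 3 * X - C m₄ * X)⁻¹) ^ (3 * i)) := by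
    unfold summand; ring
  rw [this, PowerSeries.coeff_X_pow_mul', if_neg (by omega)]

open scoped PowerSeries.WithPiTopology in
/-- `summandSum` is the sum of the series in the usual topology on formal power series. -/
theorem hasSum_summand (m₄ : ℝ) : HasSum (summand m₄) (summandSum m₄) := by
  rw [PowerSeries.WithPiTopology.hasSum_iff_hasSum_coeff]
  intro n
  rw [summandSum, PowerSeries.coeff_mk]
  refine hasSum_sum_of_ne_finset_zero fun i hi => coeff_summand_eq_zero m₄ ?_
  simpa using hi

end SixthMoment

end

noncomputable section

namespace SixthMoment

/-! Expanding `det ^ 6` over six permutations turns the moment into the signed weighted sum of all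
`6 × n` tables (`detMoment_eq_tableSum`). Encode this sum in the exterior algebra on generators
indexed by a number `j` and a colour `q` (one of the six rows of the table): a table column is a
word of six generators, one of each colour, and the table sum is the top coefficient of the `n`-th
power of the weighted sum of all words (`tableSum_eq_ctop`). Words have even degree, so everything
takes place in the commutative centre.

The weight of a word depends only on which colours carry equal numbers. The moment-cumulant formula
`fiberWeight_eq` writes it as a sum over coarser-to-finer partitions of the six colours of types 6,
4+2, 3+3 and 2+2+2, with coefficients `κ₆ = m₆ - 10 m₃² - 15 m₄ + 30`, `κ₄ = m₄ - 3`, `m₃²` and 1.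
Summing over numbers, the types other than 3+3 give the polynomial `rowPoly` in the power sums `∑ j,
colElem j v`, the type 2+2+2 giving a `6 × 6` Pfaffian.

The ten sums of type 3+3 each have square zero. A sign change on one number shows that, under the
top coefficient, only the terms with both triples on the same number survive, so such a sum acts
like the full-column sum (`ctop_prod_tripleSum_mul`). Choosing `r` distinct ones among ten gives the
factor `(1 + m₃² t) ^ 10`.

For polynomials in the power sums, extracting the generators of one number amounts to applying the
constant-coefficient operator `colOp = ∂_full + ∑ ∂_two ∂_four + Pf(∂)`
(`IsColumn.map_mul_aeval_add`). The variable of the full set then yields the exponential, the 4+2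
terms reduce to the Euler operator and yield powers of `(1 - κ₄ t)⁻¹`, and Cayley's identity `Pf(∂)
Pf ^ (n+1) = (n+1)(n+3)(n+5) Pf ^ n` evaluates the Pfaffian powers.

Even tables are the case where the odd moments are replaced by zero, which gives the second form. -/

/-- Index set of the polynomial variables: one for the whole set of six colours, one for each of
the fifteen pairs of colours, and one for each complement of a pair. -/
abbrev Gen : Type := Unit ⊕ (Fin 15 ⊕ Fin 15)

/-- The variable index of the full set of colours. -/
abbrev Gen.full : Gen := Sum.inl ()
/-- The variable index of the `i`-th pair. -/
abbrev Gen.two (i : Fin 15) : Gen := Sum.inr (Sum.inl i)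
/-- The variable index of the complement of the `i`-th pair. -/
abbrev Gen.four (i : Fin 15) : Gen := Sum.inr (Sum.inr i)

/-- Real polynomials in the variables indexed by `Gen`. -/
abbrev GenPoly : Type := MvPolynomial Gen ℝ

/-! ### The `6 × 6` Pfaffian and Cayley's identity. -/

/-- The pairs (in lexicographic order) of the `k`-th perfect matching of six points. -/
def matching : Fin 15 → Fin 3 → Fin 15 :=
  ![![0, 9, 14], ![0, 10, 13], ![0, 11, 12], ![1, 6, 14], ![1, 7, 13], ![1, 8, 12],
    ![2, 5, 14], ![2, 7, 11], ![2, 8, 10], ![3, 5, 13], ![3, 6, 11], ![3, 8, 9],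
    ![4, 5, 12], ![4, 6, 10], ![4, 7, 9]]

/-- The sign of the `k`-th perfect matching. -/
def matchSign : Fin 15 → ℤ := ![1, -1, 1, -1, 1, -1, 1, -1, 1, -1, 1, -1, 1, -1, 1]

/-- The Pfaffian of the generic alternating `6 × 6` matrix with upper entries `x`. -/
def pfaffian {A : Type*} [CommRing A] (x : Fin 15 → A) : A :=
  ∑ k, (matchSign k : A) * (x (matching k 0) * x (matching k 1) * x (matching k 2))

/-- The partial derivatives of the Pfaffian. -/
def pfaffianGrad {A : Type*} [CommRing A] (x : Fin 15 → A) : Fin 15 → A :=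
  ![x 9 * x 14 - x 10 * x 13 + x 11 * x 12, -(x 6 * x 14) + x 7 * x 13 - x 8 * x 12,
    x 5 * x 14 - x 7 * x 11 + x 8 * x 10, -(x 5 * x 13) + x 6 * x 11 - x 8 * x 9,
    x 5 * x 12 - x 6 * x 10 + x 7 * x 9,
    x 2 * x 14 - x 3 * x 13 + x 4 * x 12, -(x 1 * x 14) + x 3 * x 11 - x 4 * x 10,
    x 1 * x 13 - x 2 * x 11 + x 4 * x 9, -(x 1 * x 12) + x 2 * x 10 - x 3 * x 9,
    x 0 * x 14 - x 3 * x 8 + x 4 * x 7, -(x 0 * x 13) + x 2 * x 8 - x 4 * x 6,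
    x 0 * x 12 - x 2 * x 7 + x 3 * x 6,
    x 0 * x 11 - x 1 * x 8 + x 4 * x 5, -(x 0 * x 10) + x 1 * x 7 - x 3 * x 5,
    x 0 * x 9 - x 1 * x 6 + x 2 * x 5]

/-- Up to signs the gradient consists of the entries of `Pf(A) A⁻¹`, whose Pfaffian has size `Pf ^ 3
* Pf⁻¹`. -/
theorem pfaffian_pfaffianGrad {A : Type*} [CommRing A] (x : Fin 15 → A) :
    pfaffian (pfaffianGrad x) = pfaffian x ^ 2 := by
  simp [pfaffian, pfaffianGrad, Fin.sum_univ_succ, matchSign, matching]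
  ring

/-- Each pair lies in three matchings, so this is three times Euler's identity for a cubic form. -/
theorem sum_mul_pfaffianGrad {A : Type*} [CommRing A] (x : Fin 15 → A) :
    ∑ k, (x (matching k 0) * pfaffianGrad x (matching k 0) +
      x (matching k 1) * pfaffianGrad x (matching k 1) +
      x (matching k 2) * pfaffianGrad x (matching k 2)) = 9 * pfaffian x := by
  simp [pfaffian, pfaffianGrad, Fin.sum_univ_succ, matchSign, matching]
  ring

/-- The generic Pfaffian in the pair variables. -/
def genPf : GenPoly := pfaffian fun i => MvPolynomial.X (Gen.two i)

/-- The partial derivative with respect to the `i`-th pair variable. -/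
abbrev dTwo (i : Fin 15) : Derivation ℝ GenPoly GenPoly := MvPolynomial.pderiv (Gen.two i)

theorem dTwo_X (i j : Fin 15) :
    dTwo i (MvPolynomial.X (Gen.two j)) = if j = i then 1 else 0 := by
  rw [MvPolynomial.pderiv_X]
  simp [Pi.single_apply]

theorem dTwo_genPf (i : Fin 15) :
    dTwo i genPf = pfaffianGrad (fun i => MvPolynomial.X (Gen.two i)) i := by
  simp only [genPf, pfaffian, map_sum, Derivation.leibniz, dTwo_X, Derivation.map_intCast]
  fin_cases i <;> simp [pfaffianGrad, Fin.sum_univ_succ, matchSign, matching] <;> ring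

/-- Two disjoint pairs determine the third pair of their matching, so a mixed second derivative of
the Pfaffian is a single signed variable. -/
theorem dTwo_pfaffianGrad (k : Fin 15) :
    dTwo (matching k 0) (pfaffianGrad (fun i => MvPolynomial.X (Gen.two i)) (matching k 1)) =
      (matchSign k : GenPoly) * MvPolynomial.X (Gen.two (matching k 2)) ∧
    dTwo (matching k 0) (pfaffianGrad (fun i => MvPolynomial.X (Gen.two i)) (matching k 2)) =
      (matchSign k : GenPoly) * MvPolynomial.X (Gen.two (matching k 1)) ∧
    dTwo (matching k 1) (pfaffianGrad (fun i => MvPolynomial.X (Gen.two i)) (matching k 2)) =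
      (matchSign k : GenPoly) * MvPolynomial.X (Gen.two (matching k 0)) := by
  fin_cases k <;> simp [pfaffianGrad, matchSign, matching, Derivation.leibniz]

/-- The Pfaffian differential operator. -/
def pfOp : Module.End ℝ GenPoly :=
  ∑ k, (matchSign k : ℝ) • ((dTwo (matching k 0)).toLinearMap *
    ((dTwo (matching k 1)).toLinearMap * (dTwo (matching k 2)).toLinearMap))

theorem pfOp_apply (Y : GenPoly) :
    pfOp Y = ∑ k, (matchSign k : ℝ) • dTwo (matching k 0) (dTwo (matching k 1)
      (dTwo (matching k 2) Y)) := by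
  simp [pfOp]

theorem matchSign_mul_self : ∀ k, matchSign k * matchSign k = 1 := by decide

/-- Cayley's identity for the Pfaffian of a generic alternating `6 × 6` matrix. -/
theorem pfOp_genPf_pow (n : ℕ) :
    pfOp (genPf ^ (n + 1)) = (((n + 1) * (n + 3) * (n + 5) : ℕ) : ℝ) • genPf ^ n := by
  set x : Fin 15 → GenPoly := fun i => MvPolynomial.X (Gen.two i) with hx
  set g := pfaffianGrad x with hg
  -- Leibniz rule for three derivatives of a power. The truncated exponents are harmless: their
  -- terms carry a vanishing factor `n` or `n - 1`.
  have key : ∀ k, (matchSign k : ℝ) • dTwo (matching k 0) (dTwo (matching k 1)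
      (dTwo (matching k 2) (genPf ^ (n + 1)))) =
      ((n + 1) * n * (n - 1 : ℕ) : GenPoly) * genPf ^ (n - 2) *
        ((matchSign k : GenPoly) * (g (matching k 0) * g (matching k 1) * g (matching k 2))) +
      ((n + 1) * n : GenPoly) * genPf ^ (n - 1) *
        (x (matching k 0) * g (matching k 0) + x (matching k 1) * g (matching k 1) +
          x (matching k 2) * g (matching k 2)) + ((n + 1) : GenPoly) * genPf ^ n := by
    intro k
    obtain ⟨h01, h02, h12⟩ := dTwo_pfaffianGrad k
    have hs : (matchSign k : GenPoly) * (matchSign k : GenPoly) = 1 := by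
      exact_mod_cast congrArg (Int.cast : ℤ → GenPoly) (matchSign_mul_self k)
    have hX : dTwo (matching k 0) (MvPolynomial.X (Gen.two (matching k 0))) = 1 := by simp
    rw [← hx, ← hg] at h01 h02 h12
    simp only [Derivation.leibniz_pow, dTwo_genPf, ← hx, ← hg, Derivation.leibniz,
      h01, h02, h12, smul_eq_mul, nsmul_eq_mul, map_add, Derivation.map_natCast, map_zero,
      Derivation.map_intCast, hX, Nat.add_sub_cancel]
    have hsm : ∀ Y : GenPoly, (matchSign k : ℝ) • Y = (matchSign k : GenPoly) * Y := by
      intro Y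
      rw [Int.cast_smul_eq_zsmul, zsmul_eq_mul]
    rw [hsm]
    simp only [show n - 1 - 1 = n - 2 by omega]
    push_cast
    linear_combination (((n:GenPoly) + 1) * n * genPf ^ (n - 1) *
      (x (matching k 0) * g (matching k 0) + x (matching k 1) * g (matching k 1) +
          x (matching k 2) * g (matching k 2)) + ((n + 1) : GenPoly) * genPf ^ n) * hs
  rw [pfOp_apply, Finset.sum_congr rfl fun k _ => key k, Finset.sum_add_distrib,
    Finset.sum_add_distrib, ← Finset.mul_sum, ← Finset.mul_sum, sum_mul_pfaffianGrad]
  have h1 : ∑ k, (matchSign k : GenPoly) * (g (matching k 0) * g (matching k 1) *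
      g (matching k 2)) = genPf ^ 2 := pfaffian_pfaffianGrad x
  have h2 : pfaffian x = genPf := rfl
  rw [h1, h2, Nat.cast_smul_eq_nsmul, nsmul_eq_mul]
  simp only [Finset.sum_const, Finset.card_univ, Fintype.card_fin, nsmul_eq_mul]
  -- The three sums contribute `n(n-1)`, `9n` and `15` (one for each matching), and `n(n-1) + 9n +
  -- 15 = (n+3)(n+5)`.
  rcases n with _ | _ | n
  · simp
  · simp; ring
  · simp only [show n + 1 + 1 - 1 = n + 1 by omega]
    push_cast
    ring

/-! ### The column operator and the functional it defines. -/

/-- The differential operator extracting the part of top degree in one column. -/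
def colOp : Module.End ℝ GenPoly :=
  (MvPolynomial.pderiv Gen.full).toLinearMap +
  ∑ i, (dTwo i).toLinearMap * (MvPolynomial.pderiv (Gen.four i)).toLinearMap + pfOp

theorem colOp_apply (Y : GenPoly) : colOp Y = MvPolynomial.pderiv Gen.full Y +
    ∑ i, dTwo i (MvPolynomial.pderiv (Gen.four i) Y) + pfOp Y := by
  simp [colOp]

theorem pderiv_comm (v w : Gen) (Y : GenPoly) :
    MvPolynomial.pderiv v (MvPolynomial.pderiv w Y) =
      MvPolynomial.pderiv w (MvPolynomial.pderiv v Y) := by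
  have : ⁅(MvPolynomial.pderiv v : Derivation ℝ GenPoly GenPoly),
      (MvPolynomial.pderiv w : Derivation ℝ GenPoly GenPoly)⁆ = 0 := by
    apply MvPolynomial.derivation_ext
    intro i
    rw [Derivation.commutator_apply, MvPolynomial.pderiv_X, MvPolynomial.pderiv_X]
    have hc : ∀ (u : Gen) (q : Prop) [Decidable q],
        MvPolynomial.pderiv u (if q then (1 : GenPoly) else 0) = 0 := by
      intro u q _; split_ifs <;> simp
    simp [Pi.single_apply, hc]
  have h := congrArg (fun D : Derivation ℝ GenPoly GenPoly => D Y) this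
  simp only [Derivation.commutator_apply, Derivation.coe_zero, Pi.zero_apply] at h
  exact sub_eq_zero.mp h

theorem colOp_pderiv (v : Gen) (Y : GenPoly) :
    colOp (MvPolynomial.pderiv v Y) = MvPolynomial.pderiv v (colOp Y) := by
  have h2 : ∀ i, dTwo i (MvPolynomial.pderiv (Gen.four i) (MvPolynomial.pderiv v Y)) =
      MvPolynomial.pderiv v (dTwo i (MvPolynomial.pderiv (Gen.four i) Y)) := fun i => by
    rw [pderiv_comm (Gen.four i), pderiv_comm (Gen.two i)]
  have h3 : ∀ i j k, dTwo i (dTwo j (dTwo k (MvPolynomial.pderiv v Y))) =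
      MvPolynomial.pderiv v (dTwo i (dTwo j (dTwo k Y))) := fun i j k => by
    rw [pderiv_comm (Gen.two k) v, pderiv_comm (Gen.two j) v, pderiv_comm (Gen.two i) v]
  rw [colOp_apply, colOp_apply, pfOp_apply, pfOp_apply, map_add, map_add, map_sum, map_sum,
    pderiv_comm Gen.full v]
  simp only [h2, h3, Derivation.map_smul]

theorem pderiv_X_mul (v w : Gen) (Y : GenPoly) (h : v ≠ w) :
    MvPolynomial.pderiv v (MvPolynomial.X w * Y) = MvPolynomial.X w * MvPolynomial.pderiv v Y := by
  rw [MvPolynomial.pderiv_mul, MvPolynomial.pderiv_X_of_ne h.symm, zero_mul, zero_add]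

theorem pderiv_X_mul_self (v : Gen) (Y : GenPoly) :
    MvPolynomial.pderiv v (MvPolynomial.X v * Y) =
      Y + MvPolynomial.X v * MvPolynomial.pderiv v Y := by
  rw [MvPolynomial.pderiv_mul, MvPolynomial.pderiv_X_self, one_mul]

theorem pfOp_X_mul (w : Gen) (hw : ∀ i, Gen.two i ≠ w) (Y : GenPoly) :
    pfOp (MvPolynomial.X w * Y) = MvPolynomial.X w * pfOp Y := by
  simp only [pfOp_apply, Finset.mul_sum]
  refine Finset.sum_congr rfl fun k _ => ?_
  simp only [pderiv_X_mul _ w _ (hw _), mul_smul_comm]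

theorem colOp_X_full_mul (Y : GenPoly) :
    colOp (MvPolynomial.X Gen.full * Y) = MvPolynomial.X Gen.full * colOp Y + Y := by
  rw [colOp_apply, colOp_apply, pfOp_X_mul _ (by simp), pderiv_X_mul_self]
  simp only [pderiv_X_mul (Gen.four _) Gen.full _ (by simp),
    pderiv_X_mul (Gen.two _) Gen.full _ (by simp), ← Finset.mul_sum]
  ring

theorem colOp_X_four_mul (i : Fin 15) (Y : GenPoly) :
    colOp (MvPolynomial.X (Gen.four i) * Y) =
      MvPolynomial.X (Gen.four i) * colOp Y + dTwo i Y := by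
  have h : ∀ j, dTwo j (MvPolynomial.pderiv (Gen.four j) (MvPolynomial.X (Gen.four i) * Y)) =
      MvPolynomial.X (Gen.four i) * dTwo j (MvPolynomial.pderiv (Gen.four j) Y) +
        if j = i then dTwo i Y else 0 := by
    intro j
    split_ifs with hj
    · subst hj
      rw [pderiv_X_mul_self, map_add, pderiv_X_mul _ _ _ (by simp)]
      ring
    · rw [pderiv_X_mul _ _ _ (by simpa using hj), pderiv_X_mul _ _ _ (by simp), add_zero]
  rw [colOp_apply, colOp_apply, pfOp_X_mul _ (by simp), pderiv_X_mul _ _ _ (by simp)]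
  simp only [h, Finset.sum_add_distrib, Finset.sum_ite_eq', Finset.mem_univ, if_true,
    ← Finset.mul_sum]
  ring

/-- The functional obtained by extracting the part of top degree in each of `n` columns. -/
def topFunctional (n : ℕ) (Y : GenPoly) : ℝ := MvPolynomial.constantCoeff ((colOp ^ n) Y)

theorem topFunctional_zero (Y : GenPoly) : topFunctional 0 Y = MvPolynomial.constantCoeff Y := by
  simp [topFunctional]

theorem topFunctional_succ (n : ℕ) (Y : GenPoly) :
    topFunctional (n + 1) Y = topFunctional n (colOp Y) := by
  simp [topFunctional, pow_succ]

theorem topFunctional_add (n : ℕ) (Y W : GenPoly) :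
    topFunctional n (Y + W) = topFunctional n Y + topFunctional n W := by
  simp [topFunctional]

theorem topFunctional_smul (n : ℕ) (c : ℝ) (Y : GenPoly) :
    topFunctional n (c • Y) = c * topFunctional n Y := by
  rw [topFunctional, map_smul, MvPolynomial.smul_eq_C_mul]
  simp [topFunctional]

theorem topFunctional_sum {ι : Type*} (n : ℕ) (s : Finset ι) (Y : ι → GenPoly) :
    topFunctional n (∑ i ∈ s, Y i) = ∑ i ∈ s, topFunctional n (Y i) := by
  simp [topFunctional]

/-- The commutator of `colOp` with multiplication by the variable is `D`, which commutes with
`colOp`. Moving the variable to the left past `n + 1` copies leaves `n + 1` terms with `D`, and the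
constant coefficient kills the rest. -/
theorem topFunctional_X_mul_of (v : Gen) (D : GenPoly →ₗ[ℝ] GenPoly)
    (hD : ∀ Y, colOp (D Y) = D (colOp Y))
    (h : ∀ Y, colOp (MvPolynomial.X v * Y) = MvPolynomial.X v * colOp Y + D Y) (n : ℕ)
    (Y : GenPoly) :
    topFunctional (n + 1) (MvPolynomial.X v * Y) = (n + 1) * topFunctional n (D Y) := by
  have key : ∀ n Y, (colOp ^ (n + 1)) (MvPolynomial.X v * Y) =
      MvPolynomial.X v * (colOp ^ (n + 1)) Y + ((n + 1 : ℕ) : ℝ) • (colOp ^ n) (D Y) := by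
    intro n
    induction n with
    | zero => intro Y; simp [h]
    | succ n ih =>
      intro Y
      rw [pow_succ, Module.End.mul_apply, Module.End.mul_apply, h, map_add, ih, ← hD, add_assoc,
        pow_succ colOp n, Module.End.mul_apply]
      congr 1
      push_cast
      module
  rw [topFunctional, key]
  simp [topFunctional, MvPolynomial.smul_eq_C_mul]

theorem topFunctional_X_full_mul (n : ℕ) (Y : GenPoly) :
    topFunctional (n + 1) (MvPolynomial.X Gen.full * Y) = (n + 1) * topFunctional n Y :=
  topFunctional_X_mul_of _ LinearMap.id (fun _ => rfl) colOp_X_full_mul n Y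

theorem topFunctional_X_four_mul (i : Fin 15) (n : ℕ) (Y : GenPoly) :
    topFunctional (n + 1) (MvPolynomial.X (Gen.four i) * Y) =
      (n + 1) * topFunctional n (dTwo i Y) :=
  topFunctional_X_mul_of _ (dTwo i).toLinearMap (fun _ => colOp_pderiv _ _)
    (colOp_X_four_mul i) n Y

/-- The sum of the products of a pair variable and the complementary variable. -/
def genCross : GenPoly := ∑ i, MvPolynomial.X (Gen.two i) * MvPolynomial.X (Gen.four i)

/-- The Euler operator of the pair variables. -/
def euler : Derivation ℝ GenPoly GenPoly :=
  ∑ i, (MvPolynomial.X (Gen.two i) : GenPoly) • dTwo i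

theorem euler_apply (Y : GenPoly) : euler Y = ∑ i, MvPolynomial.X (Gen.two i) * dTwo i Y := by
  rw [euler, ← Derivation.coeFnAddMonoidHom_apply, map_sum, Finset.sum_apply]
  rfl

theorem euler_X_two (i : Fin 15) :
    euler (MvPolynomial.X (Gen.two i)) = MvPolynomial.X (Gen.two i) := by
  rw [euler_apply]
  simp [Pi.single_apply]

theorem euler_X_four (i : Fin 15) : euler (MvPolynomial.X (Gen.four i)) = 0 := by
  rw [euler_apply]
  simp

theorem euler_genPf : euler genPf = 3 * genPf := by
  simp only [genPf, pfaffian, map_sum, Derivation.leibniz, euler_X_two, Derivation.map_intCast,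
    smul_eq_mul, Finset.mul_sum]
  refine Finset.sum_congr rfl fun k _ => ?_
  ring

theorem euler_genCross : euler genCross = genCross := by
  simp only [genCross, map_sum, Derivation.leibniz, euler_X_two, euler_X_four, smul_eq_mul]
  refine Finset.sum_congr rfl fun k _ => ?_
  ring

theorem euler_cross_pow_mul (k N : ℕ) : euler (genCross ^ k * genPf ^ N) =
    ((k + 3 * N : ℕ) : ℝ) • (genCross ^ k * genPf ^ N) := by
  have hp : ∀ {Y : GenPoly} {c : ℕ}, euler Y = (c : GenPoly) * Y → ∀ m : ℕ,
      euler (Y ^ m) = ((m * c : ℕ) : GenPoly) * Y ^ m := by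
    intro Y c h m
    induction m with
    | zero => simp
    | succ m ih =>
      rw [pow_succ, Derivation.leibniz, ih, h]
      simp only [smul_eq_mul]
      push_cast
      ring
  rw [Derivation.leibniz, hp (c := 1) (by rw [euler_genCross]; simp) k,
    hp (c := 3) (by rw [euler_genPf]; simp) N, Nat.cast_smul_eq_nsmul, nsmul_eq_mul]
  simp only [smul_eq_mul]
  push_cast
  ring

/-- Each complementary variable becomes the derivative in its pair variable, and `∑ ∂ᵢ (xᵢ Y) = 15 Y
+ euler Y`. -/
theorem topFunctional_cross_mul (n : ℕ) (Y : GenPoly) :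
    topFunctional (n + 1) (genCross * Y) =
      (n + 1) * (15 * topFunctional n Y + topFunctional n (euler Y)) := by
  have h : genCross * Y =
      ∑ i, MvPolynomial.X (Gen.four i) * (MvPolynomial.X (Gen.two i) * Y) := by
    rw [genCross, Finset.sum_mul]
    refine Finset.sum_congr rfl fun i _ => ?_
    ring
  rw [h, topFunctional_sum]
  simp only [topFunctional_X_four_mul, pderiv_X_mul_self, topFunctional_add, ← Finset.mul_sum,
    Finset.sum_add_distrib, euler_apply, topFunctional_sum]
  simp

theorem topFunctional_cross_pow_mul_genPf_pow (k N : ℕ) :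
    topFunctional (k + N) (genCross ^ k * genPf ^ N) * N.factorial =
      (k + N).factorial * ((15 + 3 * N).ascFactorial k) * topFunctional N (genPf ^ N) := by
  induction k with
  | zero => simp; ring
  | succ k ih =>
    rw [show k + 1 + N = k + N + 1 by ring, pow_succ', mul_assoc, topFunctional_cross_mul,
      euler_cross_pow_mul, topFunctional_smul, Nat.factorial_succ, Nat.ascFactorial_succ]
    push_cast
    linear_combination ((k : ℝ) + N + 1) * (15 + k + 3 * N) * ih

theorem pderiv_genPf_pow_eq_zero (v : Gen) (hv : ∀ i, Gen.two i ≠ v) (N : ℕ) :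
    MvPolynomial.pderiv v (genPf ^ N) = 0 := by
  have h : MvPolynomial.pderiv v genPf = 0 := by
    simp [genPf, pfaffian, Derivation.leibniz, MvPolynomial.pderiv_X_of_ne (hv _)]
  rw [Derivation.leibniz_pow, h]
  simp

/-- Only the Pfaffian part of `colOp` acts on powers of `genPf`, so Cayley's identity iterates; `48
= 2! * 4!` comes from the products of `N + 3` and `N + 5` starting at 3 and 5. -/
theorem topFunctional_genPf_pow (N : ℕ) :
    topFunctional N (genPf ^ N) * 48 = N.factorial * (N + 2).factorial * (N + 4).factorial := by
  induction N with
  | zero => simp [topFunctional_zero]; norm_num [Nat.factorial]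
  | succ N ih =>
    have h : colOp (genPf ^ (N + 1)) =
        (((N + 1) * (N + 3) * (N + 5) : ℕ) : ℝ) • genPf ^ N := by
      rw [colOp_apply, pderiv_genPf_pow_eq_zero _ (by simp), pfOp_genPf_pow]
      simp [pderiv_genPf_pow_eq_zero (Gen.four _) (by simp)]
    rw [topFunctional_succ, h, topFunctional_smul, mul_assoc, ih,
      show N + 1 + 2 = (N + 2) + 1 by ring, show N + 1 + 4 = (N + 4) + 1 by ring]
    simp only [Nat.factorial_succ]
    push_cast
    ring

/-- The two colours of the `i`-th pair, in lexicographic order. -/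
def pairColor : Fin 15 → Fin 2 → Fin 6 :=
  ![![0, 1], ![0, 2], ![0, 3], ![0, 4], ![0, 5], ![1, 2], ![1, 3], ![1, 4], ![1, 5],
    ![2, 3], ![2, 4], ![2, 5], ![3, 4], ![3, 5], ![4, 5]]

/-- Whether the colour set indexed by a generator contains a given colour. -/
def Gen.has : Gen → Fin 6 → Bool
  | Sum.inl _, _ => true
  | Sum.inr (Sum.inl i), q => decide (q = pairColor i 0) || decide (q = pairColor i 1)
  | Sum.inr (Sum.inr i), q => !(decide (q = pairColor i 0) || decide (q = pairColor i 1))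

/-! ### Contracting one column in a commutative algebra. -/

section Taylor

variable {σ Z : Type*} [Fintype σ] [CommRing Z] [Algebra ℝ Z]

open MvPolynomial in
-- Taylor's formula, exact at first order because all products of two increments vanish.
theorem aeval_add_of_mul_eq_zero (X x : σ → Z) (h : ∀ v w, x v * x w = 0)
    (Y : MvPolynomial σ ℝ) :
    aeval (X + x) Y = aeval X Y + ∑ v, x v * aeval X (pderiv v Y) := by
  classical
  induction Y using MvPolynomial.induction_on with
  | C a => simp
  | add p q hp hq =>
    rw [map_add, map_add, hp, hq]
    simp only [map_add, mul_add, Finset.sum_add_distrib]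
    ring
  | mul_X p w hp =>
    have h0 : (∑ v, x v * aeval X (pderiv v p)) * x w = 0 := by
      rw [Finset.sum_mul]
      refine Finset.sum_eq_zero fun v _ => ?_
      rw [mul_right_comm, h, zero_mul]
    have h1 : ∀ v, x v * aeval X (pderiv v (p * MvPolynomial.X w)) =
        x v * aeval X (pderiv v p) * X w + if v = w then x w * aeval X p else 0 := by
      intro v
      rw [pderiv_mul, map_add, map_mul, map_mul, aeval_X]
      split_ifs with hv
      · subst hv
        rw [pderiv_X_self]
        simp
        ring
      · rw [pderiv_X_of_ne (Ne.symm hv)]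
        simp
        ring
    simp only [h1, Finset.sum_add_distrib, Finset.sum_ite_eq', Finset.mem_univ, if_true]
    rw [map_mul, hp, map_mul, aeval_X, aeval_X, ← Finset.sum_mul, Pi.add_apply]
    linear_combination h0

omit [Fintype σ] in
open MvPolynomial in
theorem mul_aeval_congr (z : Z) (X X' : σ → Z) (h : ∀ v, z * X v = z * X' v)
    (Y : MvPolynomial σ ℝ) : z * aeval X Y = z * aeval X' Y := by
  induction Y using MvPolynomial.induction_on with
  | C a => simp
  | add p q hp hq => rw [map_add, map_add, mul_add, mul_add, hp, hq]
  | mul_X p w hp =>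
    rw [map_mul, map_mul, ← mul_assoc, hp, aeval_X, aeval_X, mul_right_comm, h, mul_right_comm,
      mul_assoc]

omit [Fintype σ] in
theorem aeval_mem_subalgebra (F : Subalgebra ℝ Z) (X : σ → Z) (h : ∀ v, X v ∈ F)
    (Y : MvPolynomial σ ℝ) : MvPolynomial.aeval X Y ∈ F := by
  induction Y using MvPolynomial.induction_on with
  | C a => rw [MvPolynomial.aeval_C]; exact F.algebraMap_mem a
  | add p q hp hq => rw [map_add]; exact F.add_mem hp hq
  | mul_X p w hp => rw [map_mul, MvPolynomial.aeval_X]; exact F.mul_mem hp (h w)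

end Taylor

/-- The elements of a column in a commutative algebra, with a functional `T` vanishing on the
subalgebras `F q` of elements that do not involve the colour `q`. -/
structure IsColumn {Z : Type*} [CommRing Z] [Algebra ℝ Z] (T : Z →ₗ[ℝ] ℝ)
    (F : Fin 6 → Subalgebra ℝ Z) (x : Gen → Z) : Prop where
  map_eq_zero : ∀ q, ∀ z ∈ F q, T z = 0
  mem_of_not_has : ∀ v q, Gen.has v q = false → x v ∈ F q
  mul_eq_zero : ∀ v w q, Gen.has v q = true → Gen.has w q = true → x v * x w = 0
  two_mul_four : ∀ i, x (Gen.two i) * x (Gen.four i) = x Gen.full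
  two_mul_two_mul_two : ∀ k, x (Gen.two (matching k 0)) * (x (Gen.two (matching k 1)) *
    x (Gen.two (matching k 2))) = (matchSign k : ℝ) • x Gen.full

namespace IsColumn

variable {Z : Type*} [CommRing Z] [Algebra ℝ Z] {T : Z →ₗ[ℝ] ℝ}
    {F : Fin 6 → Subalgebra ℝ Z} {x : Gen → Z}

/-- `T` needs the colour `q`, which neither `z` nor `X` supplies, and two generators containing `q`
multiply to zero. Hence exactly one generator containing `q` is used, and Taylor's formula at first
order applies to these. After multiplication by it, the other generators containing `q` may be put
back in the argument. The set `s` keeps those not killed by `z`. -/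
theorem contract (hx : IsColumn T F x) {X : Gen → Z} {q : Fin 6} (hX : ∀ v, X v ∈ F q)
    {z : Z} (hz : z ∈ F q) (s : Finset Gen)
    (hs : ∀ v, Gen.has v q = true → v ∉ s → z * x v = 0)
    (hs' : ∀ v ∈ s, Gen.has v q = true) (Y : GenPoly) :
    T (z * MvPolynomial.aeval (X + x) Y) =
      ∑ v ∈ s, T (z * x v * MvPolynomial.aeval (X + x) (MvPolynomial.pderiv v Y)) := by
  set x' : Gen → Z := fun v => if Gen.has v q then 0 else x v with hx'
  set x'' : Gen → Z := fun v => if Gen.has v q then x v else 0 with hx''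
  have hsum : X + x = (X + x') + x'' := by
    funext v
    simp only [hx', hx'', Pi.add_apply]
    split_ifs <;> simp
  have h0 : ∀ v w, x'' v * x'' w = 0 := by
    intro v w
    simp only [hx'']
    split_ifs with h1 h2
    · exact hx.mul_eq_zero v w q h1 h2
    all_goals simp
  have hF : ∀ v, (X + x') v ∈ F q := by
    intro v
    refine (F q).add_mem (hX v) ?_
    simp only [hx']
    split_ifs with h1
    · exact (F q).zero_mem
    · exact hx.mem_of_not_has v q (by simpa using h1)
  have h2 : ∀ v, T (z * (x'' v * MvPolynomial.aeval (X + x') (MvPolynomial.pderiv v Y))) =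
      if v ∈ s then T (z * x v * MvPolynomial.aeval (X + x) (MvPolynomial.pderiv v Y)) else 0 := by
    intro v
    by_cases h1 : Gen.has v q = true
    · simp only [hx'', h1, if_true]
      split_ifs with hvs
      · rw [mul_assoc]
        congr 2
        apply mul_aeval_congr
        intro w
        simp only [hx', Pi.add_apply, mul_add]
        split_ifs with hw
        · rw [hx.mul_eq_zero v w q h1 hw, mul_zero]
        · rfl
      · rw [← mul_assoc, hs v h1 hvs, zero_mul, map_zero]
    · rw [if_neg (fun h => h1 (hs' v h))]
      simp [hx'', h1]
  rw [hsum, aeval_add_of_mul_eq_zero _ _ h0, mul_add, map_add,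
    hx.map_eq_zero q _ ((F q).mul_mem hz (aeval_mem_subalgebra _ _ hF _)), zero_add,
    Finset.mul_sum, map_sum, Finset.sum_congr rfl fun v _ => h2 v, Finset.sum_ite_mem,
    Finset.univ_inter, ← hsum]

theorem full_mul (hx : IsColumn T F x) (X : Gen → Z) (Y : GenPoly) :
    x Gen.full * MvPolynomial.aeval (X + x) Y = x Gen.full * MvPolynomial.aeval X Y := by
  apply mul_aeval_congr
  intro v
  have : ∀ v : Gen, ∃ q, Gen.has v q = true := by decide
  obtain ⟨q, hq⟩ := this v
  rw [Pi.add_apply, mul_add, hx.mul_eq_zero Gen.full v q rfl hq, add_zero]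

/-- A product with a generator vanishes if they have a colour in common. -/
theorem mul_mul_eq_zero (hx : IsColumn T F x) (z : Z) {v w : Gen}
    (h : ∃ q, Gen.has v q = true ∧ Gen.has w q = true) : z * x v * x w = 0 := by
  obtain ⟨q, h1, h2⟩ := h
  rw [mul_assoc, hx.mul_eq_zero v w q h1 h2, mul_zero]

theorem contract_four (hx : IsColumn T F x) {X : Gen → Z} (hX : ∀ q v, X v ∈ F q)
    {u : Z} (hu : ∀ q, u ∈ F q) (i : Fin 15) (Y : GenPoly) :
    T (u * x (Gen.four i) * MvPolynomial.aeval (X + x) Y) =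
      T (u * x Gen.full * MvPolynomial.aeval X (dTwo i Y)) := by
  have h1 : ∀ i, Gen.has (Gen.four i) (pairColor i 0) = false := by decide
  have h2 : ∀ i v, Gen.has v (pairColor i 0) = true → v ∉ ({Gen.two i} : Finset Gen) →
    ∃ q, Gen.has (Gen.four i) q = true ∧ Gen.has v q = true := by decide +kernel
  have h3 : ∀ i, Gen.has (Gen.two i) (pairColor i 0) = true := by decide
  rw [hx.contract (hX (pairColor i 0)) ((F _).mul_mem (hu _) (hx.mem_of_not_has _ _ (h1 i)))
    {Gen.two i} (fun v hv hvs => hx.mul_mul_eq_zero u (h2 i v hv hvs))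
    (by simpa using h3 i), Finset.sum_singleton, mul_assoc u, mul_comm (x (Gen.four i)),
    hx.two_mul_four, mul_assoc, hx.full_mul, mul_assoc]

theorem contract_two_two (hx : IsColumn T F x) {X : Gen → Z} (hX : ∀ q v, X v ∈ F q)
    {u : Z} (hu : ∀ q, u ∈ F q) (k : Fin 15) (Y : GenPoly) :
    T (u * x (Gen.two (matching k 0)) * x (Gen.two (matching k 1)) *
        MvPolynomial.aeval (X + x) Y) =
      (matchSign k : ℝ) * T (u * x Gen.full * MvPolynomial.aeval X (dTwo (matching k 2) Y)) := by
  have h1 : ∀ k, Gen.has (Gen.two (matching k 0)) (pairColor (matching k 2) 0) = false ∧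
    Gen.has (Gen.two (matching k 1)) (pairColor (matching k 2) 0) = false ∧
    Gen.has (Gen.two (matching k 2)) (pairColor (matching k 2) 0) = true := by decide
  have h2 : ∀ k v, Gen.has v (pairColor (matching k 2) 0) = true →
    v ∉ ({Gen.two (matching k 2)} : Finset Gen) →
    (∃ q, Gen.has (Gen.two (matching k 0)) q = true ∧ Gen.has v q = true) ∨
    (∃ q, Gen.has (Gen.two (matching k 1)) q = true ∧ Gen.has v q = true) := by decide +kernel
  rw [hx.contract (hX (pairColor (matching k 2) 0)) ((F _).mul_mem ((F _).mul_mem (hu _)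
    (hx.mem_of_not_has _ _ (h1 k).1)) (hx.mem_of_not_has _ _ (h1 k).2.1))
    {Gen.two (matching k 2)} (fun v hv hvs => ?_) (by simpa using (h1 k).2.2),
    Finset.sum_singleton, mul_assoc (u * _), mul_assoc u, hx.two_mul_two_mul_two,
    mul_smul_comm, smul_mul_assoc, map_smul, smul_eq_mul, mul_assoc, hx.full_mul, mul_assoc]
  rcases h2 k v hv hvs with h | h
  · rw [mul_right_comm, hx.mul_mul_eq_zero _ h, zero_mul]
  · exact hx.mul_mul_eq_zero _ h

/-- The `t`-th of the three matchings containing the `i`-th pair, which contains the colour 0. -/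
def matchIndex (i : Fin 5) (t : Fin 3) : Fin 15 := (finProdFinEquiv (i, t) : Fin (5 * 3))

/-- Take a colour outside the pair: it is supplied either by the complement, which fills the column,
or by one of three pairs, after which `contract_two_two` supplies the last pair. -/
theorem contract_two (hx : IsColumn T F x) {X : Gen → Z} (hX : ∀ q v, X v ∈ F q)
    {u : Z} (hu : ∀ q, u ∈ F q) (i : Fin 5) (Y : GenPoly) :
    T (u * x (Gen.two (Fin.castAdd 10 i)) * MvPolynomial.aeval (X + x) Y) =
      T (u * x Gen.full * MvPolynomial.aeval X
        (MvPolynomial.pderiv (Gen.four (Fin.castAdd 10 i)) Y)) +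
      ∑ t, (matchSign (matchIndex i t) : ℝ) * T (u * x Gen.full * MvPolynomial.aeval X
        (dTwo (matching (matchIndex i t) 2) (dTwo (matching (matchIndex i t) 1) Y))) := by
  have h1 : ∀ i : Fin 5, Gen.has (Gen.two (Fin.castAdd 10 i))
    (pairColor (matching (matchIndex i 0) 1) 0) = false := by decide
  have h2 : ∀ (i : Fin 5) v, Gen.has v (pairColor (matching (matchIndex i 0) 1) 0) = true →
    v ∉ insert (Gen.four (Fin.castAdd 10 i))
      (Finset.univ.image fun t => Gen.two (matching (matchIndex i t) 1)) →
    ∃ q, Gen.has (Gen.two (Fin.castAdd 10 i)) q = true ∧ Gen.has v q = true := by decide +kernel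
  have h3 : ∀ (i : Fin 5), ∀ v ∈ insert (Gen.four (Fin.castAdd 10 i))
      (Finset.univ.image fun t => Gen.two (matching (matchIndex i t) 1)),
      Gen.has v (pairColor (matching (matchIndex i 0) 1) 0) = true := by decide +kernel
  have h4 : ∀ (i : Fin 5) (t t' : Fin 3), matching (matchIndex i t) 1 =
      matching (matchIndex i t') 1 → t = t' := by decide
  have h5 : ∀ (i : Fin 5) (t : Fin 3), Fin.castAdd 10 i = matching (matchIndex i t) 0 := by
    decide
  rw [hx.contract (hX (pairColor (matching (matchIndex i 0) 1) 0)) ((F _).mul_mem (hu _)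
    (hx.mem_of_not_has _ _ (h1 i))) _ (fun v hv hvs => hx.mul_mul_eq_zero u (h2 i v hv hvs))
    (h3 i), Finset.sum_insert (by simp), Finset.sum_image (fun t _ t' _ h => h4 i t t' (by
      simpa using h)), mul_assoc u, hx.two_mul_four, mul_assoc, hx.full_mul, mul_assoc]
  congr 1
  refine Finset.sum_congr rfl fun t _ => ?_
  rw [h5 i t, hx.contract_two_two hX hu]

theorem map_mul_aeval_add (hx : IsColumn T F x) {X : Gen → Z} (hX : ∀ q v, X v ∈ F q)
    {u : Z} (hu : ∀ q, u ∈ F q) (Y : GenPoly) :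
    T (u * MvPolynomial.aeval (X + x) Y) =
      T (u * x Gen.full * MvPolynomial.aeval X (colOp Y)) := by
  set L : GenPoly →ₗ[ℝ] ℝ := T ∘ₗ LinearMap.mulLeft ℝ (u * x Gen.full) ∘ₗ
    (MvPolynomial.aeval X).toLinearMap with hL
  have hLa : ∀ W, T (u * x Gen.full * MvPolynomial.aeval X W) = L W := fun W => rfl
  have h1 : ∀ i : Fin 5, Gen.has (Gen.two (Fin.castAdd 10 i)) 0 = true ∧
    Gen.has (Gen.four (Fin.castAdd 10 i)) 0 = false := by decide
  have h2 : ∀ i : Fin 10, Gen.has (Gen.two (Fin.natAdd 5 i)) 0 = false ∧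
    Gen.has (Gen.four (Fin.natAdd 5 i)) 0 = true := by decide
  have h5 : ∀ (i : Fin 5) (t : Fin 3), matching (matchIndex i t) 0 = Fin.castAdd 10 i := by
    decide
  -- Each matching is counted once, through its pair containing colour 0.
  have hpf : L (pfOp Y) = ∑ i : Fin 5, ∑ t : Fin 3, (matchSign (matchIndex i t) : ℝ) *
      L (dTwo (matching (matchIndex i t) 2) (dTwo (matching (matchIndex i t) 1)
        (dTwo (Fin.castAdd 10 i) Y))) := by
    rw [pfOp_apply, map_sum, ← Fintype.sum_prod_type']
    symm
    refine Fintype.sum_equiv (finProdFinEquiv : Fin 5 × Fin 3 ≃ Fin (5 * 3)) _ _ ?_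
    rintro ⟨i, t⟩
    change _ = L ((matchSign (matchIndex i t) : ℝ) • dTwo (matching (matchIndex i t) 0)
      (dTwo (matching (matchIndex i t) 1) (dTwo (matching (matchIndex i t) 2) Y)))
    have h3 : ∀ a b c, dTwo a (dTwo b (dTwo c Y)) = dTwo c (dTwo b (dTwo a Y)) := by
      intro a b c
      rw [pderiv_comm (Gen.two a), pderiv_comm (Gen.two a), pderiv_comm (Gen.two b)]
    rw [map_smul, smul_eq_mul, h5, h3]
  have hs : ∀ i (W : GenPoly), T (u * x (Gen.four i) * MvPolynomial.aeval (X + x) W) =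
    L (dTwo i W) := fun i W => hx.contract_four hX hu i W
  -- Colour 0 is supplied by the full set, by one of the first five pairs, or by the complement of
  -- one of the other ten pairs; these cases together produce all terms of `colOp`.
  rw [hx.contract (hX 0) (hu 0) (Finset.univ.filter fun v => Gen.has v 0 = true)
    (fun v hv hvs => absurd (by simpa using hv) (by simpa using hvs)) (fun v hv => by
      simpa using hv), Finset.sum_filter, Fintype.sum_sum_type, Fintype.sum_sum_type, hLa,
      colOp_apply, map_add, map_add, hpf, map_sum]
  have hsplit : ∀ g : Fin 15 → ℝ, ∑ i, g i =
      ∑ i : Fin 5, g (Fin.castAdd 10 i) + ∑ i : Fin 10, g (Fin.natAdd 5 i) :=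
    fun g => Fin.sum_univ_add (a := 5) (b := 10) g
  rw [hsplit, hsplit, hsplit]
  simp only [(h1 _).1, (h1 _).2, (h2 _).1, (h2 _).2, hs, if_true, hx.contract_two hX hu, hLa,
    Finset.sum_add_distrib, Finset.univ_unique, Finset.sum_singleton]
  simp only [Bool.false_eq_true, if_false, Finset.sum_const_zero, mul_assoc, hx.full_mul]
  simp only [← mul_assoc, hLa, Gen.has, if_true, pderiv_comm (Gen.four _)]
  ring

end IsColumn

/-- Extracting the top degree part of a polynomial in the column sums, column by column. -/
theorem map_prod_mul_aeval {Z ι : Type*} [CommRing Z] [Algebra ℝ Z] [DecidableEq ι] [Fintype ι]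
    (T : Z →ₗ[ℝ] ℝ) (F : ι → Fin 6 → Subalgebra ℝ Z) (x : ι → Gen → Z)
    (hx : ∀ j, IsColumn T (F j) (x j)) (hF : ∀ j q k v, k ≠ j → x k v ∈ F j q)
    (K : Finset ι) (Y : GenPoly) :
    T ((∏ j ∈ Kᶜ, x j Gen.full) * MvPolynomial.aeval (∑ j ∈ K, x j) Y) =
      topFunctional K.card Y * T (∏ j, x j Gen.full) := by
  induction K using Finset.induction_on generalizing Y with
  | empty =>
    rw [Finset.sum_empty, Finset.card_empty, topFunctional_zero, Finset.compl_empty,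
      show (0 : Gen → Z) = fun _ => 0 from rfl, MvPolynomial.aeval_zero', mul_comm,
      ← Algebra.smul_def, map_smul, smul_eq_mul]
  | insert j K hj ih =>
    have hK : Kᶜ = insert j (insert j K)ᶜ := by
      ext k
      simp only [Finset.mem_compl, Finset.mem_insert]
      by_cases h : k = j
      · subst h; simpa using hj
      · simp [h]
    rw [Finset.sum_insert hj, add_comm (x j), (hx j).map_mul_aeval_add,
      Finset.card_insert_of_notMem hj, topFunctional_succ, ← ih, hK, Finset.prod_insert (by simp),
      mul_comm (x j Gen.full)]
    · intro q v
      rw [Finset.sum_apply]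
      exact (F j q).sum_mem fun k hk => hF j q k v (by rintro rfl; exact hj hk)
    · intro q
      refine (F j q).prod_mem fun k hk => hF j q k _ ?_
      rintro rfl
      simp at hk

/-! ### The exterior algebra and its top coefficient. -/

/-- The exterior algebra with one generator for each column and each of the six colours. -/
abbrev Ext (n : ℕ) : Type := ExteriorAlgebra ℝ (Fin n × Fin 6 → ℝ)

/-- The generator of the exterior algebra attached to a column and a colour. -/
def extGen {n : ℕ} (p : Fin n × Fin 6) : Ext n := ExteriorAlgebra.ι ℝ (Pi.single p 1)

/-- The product of the generators in a list. -/
def mon {n : ℕ} (l : List (Fin n × Fin 6)) : Ext n := (l.map extGen).prod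

theorem mon_nil {n : ℕ} : mon ([] : List (Fin n × Fin 6)) = 1 := rfl

theorem mon_cons {n : ℕ} (p : Fin n × Fin 6) (l : List (Fin n × Fin 6)) :
    mon (p :: l) = extGen p * mon l := by simp [mon]

theorem mon_append {n : ℕ} (l l' : List (Fin n × Fin 6)) :
    mon (l ++ l') = mon l * mon l' := by simp [mon]

theorem mon_ofFn {n m : ℕ} (f : Fin m → Fin n × Fin 6) :
    mon (List.ofFn f) = ExteriorAlgebra.ιMulti ℝ m fun i => Pi.single (f i) 1 := by
  rw [ExteriorAlgebra.ιMulti_apply, mon, List.map_ofFn]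
  rfl

theorem mon_eq_zero_of_not_nodup {n : ℕ} {l : List (Fin n × Fin 6)} (h : ¬ l.Nodup) :
    mon l = 0 := by
  rw [← List.ofFn_get l, mon_ofFn]
  apply ExteriorAlgebra.ιMulti_eq_zero_of_not_inj
  intro hinj
  exact h (List.nodup_iff_injective_get.mpr fun a b hab => hinj (by simp only [hab]))

theorem mon_ofFn_perm {n m : ℕ} (f : Fin m → Fin n × Fin 6) (σ : Equiv.Perm (Fin m)) :
    mon (List.ofFn fun i => f (σ i)) = ((Equiv.Perm.sign σ : ℤ) : ℝ) • mon (List.ofFn f) := by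
  rw [mon_ofFn, mon_ofFn]
  have := (ExteriorAlgebra.ιMulti ℝ m).map_perm
    (fun i => (Pi.single (f i) 1 : Fin n × Fin 6 → ℝ)) σ
  rw [show (fun i => (Pi.single (f (σ i)) 1 : Fin n × Fin 6 → ℝ)) =
    (fun i => (Pi.single (f i) 1 : Fin n × Fin 6 → ℝ)) ∘ σ from rfl, this, Int.cast_smul_eq_zsmul]
  rfl

theorem mul_ι_eq {n : ℕ} (l : List (Fin n × Fin 6)) (v : Fin n × Fin 6 → ℝ) :
    mon l * ExteriorAlgebra.ι ℝ v = (-1 : ℝ) ^ l.length • (ExteriorAlgebra.ι ℝ v * mon l) := by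
  induction l with
  | nil => simp [mon_nil]
  | cons p l ih =>
    have h := eq_neg_of_add_eq_zero_left (ExteriorAlgebra.ι_add_mul_swap (R := ℝ)
      (Pi.single p 1) v)
    rw [mon_cons, mul_assoc, ih, mul_smul_comm, ← mul_assoc, extGen, h, List.length_cons,
      pow_succ, neg_mul, mul_assoc (ExteriorAlgebra.ι ℝ v)]
    simp

theorem mon_mem_center {n : ℕ} {l : List (Fin n × Fin 6)} (h : Even l.length) :
    mon l ∈ Subalgebra.center ℝ (Ext n) := by
  rw [Subalgebra.mem_center_iff]
  intro y
  induction y using ExteriorAlgebra.induction with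
  | algebraMap r => exact Algebra.commutes _ _
  | ι v => rw [mul_ι_eq, h.neg_one_pow, one_smul]
  | mul a b ha hb => rw [mul_assoc, hb, ← mul_assoc, ha, mul_assoc]
  | add a b ha hb => rw [add_mul, mul_add, ha, hb]

/-- The coefficient of the product of all generators. -/
def top (n : ℕ) : Ext n →ₗ[ℝ] ℝ :=
  ExteriorAlgebra.liftAlternating
    (Pi.single (n * 6) ((Pi.basisFun ℝ (Fin n × Fin 6)).reindex finProdFinEquiv).det)

theorem top_ιMulti {n : ℕ} (v : Fin (n * 6) → Fin n × Fin 6 → ℝ) :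
    top n (ExteriorAlgebra.ιMulti ℝ (n * 6) v) =
      ((Pi.basisFun ℝ (Fin n × Fin 6)).reindex finProdFinEquiv).det v := by
  rw [top, ExteriorAlgebra.liftAlternating_apply_ιMulti, Pi.single_eq_same]

/-- The top exterior power is one-dimensional and `φ` acts on it by its determinant. The maps used
below kill one generator or negate the generators of one column. -/
theorem top_map {n : ℕ} (φ : (Fin n × Fin 6 → ℝ) →ₗ[ℝ] (Fin n × Fin 6 → ℝ)) (z : Ext n) :
    top n (ExteriorAlgebra.map φ z) = LinearMap.det φ * top n z := by
  have h : top n ∘ₗ (ExteriorAlgebra.map φ).toLinearMap = LinearMap.det φ • top n := by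
    apply ExteriorAlgebra.lhom_ext
    intro i
    ext v
    simp only [LinearMap.compAlternatingMap_apply, LinearMap.comp_apply, AlgHom.toLinearMap_apply,
      ExteriorAlgebra.map_apply_ιMulti, LinearMap.smul_apply]
    by_cases hi : i = n * 6
    · subst hi
      rw [top_ιMulti, top_ιMulti, Module.Basis.det_comp, smul_eq_mul]
    · rw [top, ExteriorAlgebra.liftAlternating_apply_ιMulti,
        ExteriorAlgebra.liftAlternating_apply_ιMulti, Pi.single_eq_of_ne hi]
      simp
  exact LinearMap.congr_fun h z

/-- The linear map multiplying each basis vector by a scalar. -/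
def scale {n : ℕ} (c : Fin n × Fin 6 → ℝ) : (Fin n × Fin 6 → ℝ) →ₗ[ℝ] (Fin n × Fin 6 → ℝ) :=
  Matrix.toLin' (Matrix.diagonal c)

theorem det_scale {n : ℕ} (c : Fin n × Fin 6 → ℝ) : LinearMap.det (scale c) = ∏ p, c p := by
  rw [scale, LinearMap.det_toLin', Matrix.det_diagonal]

theorem scale_single {n : ℕ} (c : Fin n × Fin 6 → ℝ) (p : Fin n × Fin 6) :
    scale c (Pi.single p 1) = c p • Pi.single p 1 := by
  rw [scale, Matrix.toLin'_apply]
  ext r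
  rw [Matrix.mulVec_diagonal]
  by_cases h : r = p
  · subst h; simp
  · simp [h]

theorem map_scale_mon {n : ℕ} (c : Fin n × Fin 6 → ℝ) (l : List (Fin n × Fin 6)) :
    ExteriorAlgebra.map (scale c) (mon l) = (l.map c).prod • mon l := by
  induction l with
  | nil => simp [mon_nil]
  | cons p l ih =>
    rw [mon_cons, map_mul, ih, extGen, ExteriorAlgebra.map_apply_ι, scale_single, map_smul,
      List.map_cons, List.prod_cons, smul_mul_smul_comm]

/-- The centre of the exterior algebra. -/
abbrev ExtCenter (n : ℕ) : Type := Subalgebra.center ℝ (Ext n)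

/-- The product of the generators in a list of even length, as a central element. -/
def cmon {n : ℕ} (l : List (Fin n × Fin 6)) (h : Even l.length) : ExtCenter n :=
  ⟨mon l, mon_mem_center h⟩

/-- The product of six generators of all colours, with columns given by `J`. -/
def word {n : ℕ} (J : Fin 6 → Fin n) : ExtCenter n :=
  cmon (List.ofFn fun q => (J q, q)) (by simp; decide)

/-- The top coefficient as a functional on the centre. -/
def ctop (n : ℕ) : ExtCenter n →ₗ[ℝ] ℝ := top n ∘ₗ (Subalgebra.center ℝ (Ext n)).val.toLinearMap

theorem coe_word {n : ℕ} (J : Fin 6 → Fin n) :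
    (word J : Ext n) = mon (List.ofFn fun q => (J q, q)) := rfl

/-- The product lists the generators in the order of the reindexed basis, so its top coefficient is
the determinant of a matrix that is block diagonal in the colours. -/
theorem ctop_prod_word {n : ℕ} (J : Fin n → Fin 6 → Fin n) :
    ctop n (∏ i, word (J i)) =
      ∏ q, (Matrix.of fun j i => if J i q = j then (1 : ℝ) else 0).det := by
  have h1 : ((∏ i, word (J i) : ExtCenter n) : Ext n) =
      ExteriorAlgebra.ιMulti ℝ (n * 6) fun k =>
        Pi.single (J (finProdFinEquiv.symm k).1 (finProdFinEquiv.symm k).2,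
          (finProdFinEquiv.symm k).2) 1 := by
    rw [← mon_ofFn, List.ofFn_mul, mon, List.map_flatten, List.prod_flatten, ← List.prod_ofFn,
      ← Subalgebra.coe_val, map_list_prod, List.map_ofFn, List.map_ofFn, List.map_ofFn]
    congr 2
    funext i
    simp only [Function.comp_apply, Subalgebra.coe_val, coe_word, mon]
    congr 3
    funext q
    have : finProdFinEquiv.symm (⟨i * 6 + q, by omega⟩ : Fin (n * 6)) = (i, q) := by
      rw [Equiv.symm_apply_eq]
      ext
      simp [finProdFinEquiv]
      ring
    rw [this]
  rw [ctop, LinearMap.comp_apply, AlgHom.toLinearMap_apply, Subalgebra.coe_val, h1, top_ιMulti,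
    Module.Basis.det_apply, ← Matrix.det_blockDiagonal, ← Matrix.det_reindex_self finProdFinEquiv]
  congr 1
  ext l k
  rw [Module.Basis.toMatrix_apply, Module.Basis.repr_reindex_apply, Pi.basisFun_repr]
  simp [Matrix.blockDiagonal_apply, Pi.single_apply, Prod.ext_iff, ite_and]
  by_cases h : l.modNat = k.modNat <;> simp [h, eq_comm]

/-! ### Colour blocks and the central elements of a column. -/

/-- The four colours outside the `i`-th pair. -/
def complColor : Fin 15 → Fin 4 → Fin 6 :=
  ![![2, 3, 4, 5], ![1, 3, 4, 5], ![1, 2, 4, 5], ![1, 2, 3, 5], ![1, 2, 3, 4], ![0, 3, 4, 5],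
    ![0, 2, 4, 5], ![0, 2, 3, 5], ![0, 2, 3, 4], ![0, 1, 4, 5], ![0, 1, 3, 5], ![0, 1, 3, 4],
    ![0, 1, 2, 5], ![0, 1, 2, 4], ![0, 1, 2, 3]]

/-- Search for the preimage of a colour. -/
def findColor (g : Fin 6 → Fin 6) (s : Fin 6) : Fin 6 :=
  if g 0 = s then 0 else if g 1 = s then 1 else if g 2 = s then 2 else if g 3 = s then 3 else
    if g 4 = s then 4 else 5

/-- The permutation listing the `i`-th pair and then its complement. -/
def pairPerm (i : Fin 15) : Equiv.Perm (Fin 6) :=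
  let g : Fin 15 → Fin 6 → Fin 6 := fun i => ![pairColor i 0, pairColor i 1, complColor i 0,
    complColor i 1, complColor i 2, complColor i 3]
  ⟨g i, findColor (g i), by revert i; decide, by revert i; decide⟩

/-- The permutation listing the three pairs of the `k`-th perfect matching. -/
def matchPerm (k : Fin 15) : Equiv.Perm (Fin 6) :=
  let g : Fin 15 → Fin 6 → Fin 6 := fun k => ![pairColor (matching k 0) 0,
    pairColor (matching k 0) 1, pairColor (matching k 1) 0, pairColor (matching k 1) 1,
    pairColor (matching k 2) 0, pairColor (matching k 2) 1]
  ⟨g k, findColor (g k), by revert k; decide, by revert k; decide⟩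

/-- The permutation listing the `k`-th triple of colours and then its complement; there are ten
triples up to complements. -/
def triplePerm (k : Fin 10) : Equiv.Perm (Fin 6) :=
  let g : Fin 10 → Fin 6 → Fin 6 := ![![0, 1, 2, 3, 4, 5], ![0, 1, 3, 2, 4, 5],
    ![0, 1, 4, 2, 3, 5], ![0, 1, 5, 2, 3, 4], ![0, 2, 3, 1, 4, 5], ![0, 2, 4, 1, 3, 5],
    ![0, 2, 5, 1, 3, 4], ![0, 3, 4, 1, 2, 5], ![0, 3, 5, 1, 2, 4], ![0, 4, 5, 1, 2, 3]]
  ⟨g k, findColor (g k), by revert k; decide, by revert k; decide⟩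

theorem sign_matchPerm : ∀ k, ((Equiv.Perm.sign (matchPerm k) : ℤˣ) : ℤ) = matchSign k := by
  decide +kernel

/-- The colours of a generator. -/
def Gen.colors : Gen → List (Fin 6)
  | Sum.inl _ => List.ofFn id
  | Sum.inr (Sum.inl i) => [pairColor i 0, pairColor i 1]
  | Sum.inr (Sum.inr i) => [complColor i 0, complColor i 1, complColor i 2, complColor i 3]

/-- The sign attached to a generator. -/
def Gen.sgn : Gen → ℝ
  | Sum.inl _ => 1
  | Sum.inr (Sum.inl _) => 1
  | Sum.inr (Sum.inr i) => ((Equiv.Perm.sign (pairPerm i) : ℤ) : ℝ)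

theorem Gen.even_length_colors : ∀ v : Gen, Even (Gen.colors v).length := by decide

theorem Gen.mem_colors_iff : ∀ (v : Gen) (q : Fin 6), q ∈ Gen.colors v ↔ Gen.has v q = true := by
  decide +kernel

/-- The central elements of a column. -/
def colElem {n : ℕ} (j : Fin n) (v : Gen) : ExtCenter n :=
  Gen.sgn v • cmon ((Gen.colors v).map fun q => (j, q)) (by
    rw [List.length_map]; exact Gen.even_length_colors v)

theorem coe_colElem {n : ℕ} (j : Fin n) (v : Gen) :
    (colElem j v : Ext n) = Gen.sgn v • mon ((Gen.colors v).map fun q => (j, q)) := rfl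

/-- The central elements not involving a given column and colour. -/
def avoid {n : ℕ} (j : Fin n) (q : Fin 6) : Subalgebra ℝ (ExtCenter n) :=
  (AlgHom.equalizer (ExteriorAlgebra.map (scale fun p => if p = (j, q) then 0 else 1))
    (AlgHom.id ℝ (Ext n))).comap (Subalgebra.center ℝ (Ext n)).val

theorem mem_avoid {n : ℕ} {j : Fin n} {q : Fin 6} {z : ExtCenter n} : z ∈ avoid j q ↔
    ExteriorAlgebra.map (scale fun p => if p = (j, q) then 0 else 1) (z : Ext n) = z := Iff.rfl

theorem cmon_mem_avoid {n : ℕ} {j : Fin n} {q : Fin 6} {l : List (Fin n × Fin 6)}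
    (hl : Even l.length) (h : (j, q) ∉ l) : cmon l hl ∈ avoid j q := by
  rw [mem_avoid]
  change ExteriorAlgebra.map _ (mon l) = mon l
  rw [map_scale_mon, List.prod_eq_one, one_smul]
  intro x hx
  obtain ⟨p, hp, rfl⟩ := List.mem_map.mp hx
  rw [if_neg]
  rintro rfl
  exact h hp

/-- The map killing the generator `(j, q)` fixes `z` but has determinant zero. -/
theorem ctop_eq_zero_of_mem_avoid {n : ℕ} {j : Fin n} {q : Fin 6} {z : ExtCenter n}
    (hz : z ∈ avoid j q) : ctop n z = 0 := by
  have h := top_map (scale fun p => if p = (j, q) then 0 else 1) (z : Ext n)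
  rw [mem_avoid.mp hz, det_scale, Finset.prod_eq_zero (Finset.mem_univ (j, q)) (by simp),
    zero_mul] at h
  exact h

theorem colElem_mem_avoid {n : ℕ} {j k : Fin n} {q : Fin 6} {v : Gen}
    (h : k ≠ j ∨ Gen.has v q = false) : colElem k v ∈ avoid j q := by
  refine (avoid j q).smul_mem (cmon_mem_avoid _ ?_) _
  intro hm
  obtain ⟨q', hq', he⟩ := List.mem_map.mp hm
  obtain ⟨rfl, rfl⟩ := Prod.ext_iff.mp he
  rw [Gen.mem_colors_iff] at hq'
  rcases h with h | h
  · exact h rfl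
  · rw [h] at hq'; exact absurd hq' (by simp)

theorem colElem_full {n : ℕ} (j : Fin n) : colElem j Gen.full = word fun _ => j := by
  apply Subtype.ext
  rw [coe_colElem, coe_word, Gen.sgn, one_smul, Gen.colors, List.map_ofFn]
  rfl

/-- Rearranging a word according to a permutation of the colours. -/
theorem coe_word_perm {n : ℕ} (J : Fin 6 → Fin n) (σ : Equiv.Perm (Fin 6)) :
    (word J : Ext n) =
      ((Equiv.Perm.sign σ : ℤ) : ℝ) • mon (List.ofFn fun t => (J (σ t), σ t)) := by
  rw [mon_ofFn_perm (fun q => (J q, q)) σ, smul_smul, coe_word]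
  rcases Int.units_eq_one_or (Equiv.Perm.sign σ) with h | h <;> simp [h]

/-- The block of a colour with respect to the `i`-th pair. -/
def pairBlock (i : Fin 15) (q : Fin 6) : Fin 2 := if Gen.has (Gen.two i) q then 0 else 1

/-- The block of a colour with respect to the `k`-th perfect matching. -/
def matchBlock (k : Fin 15) (q : Fin 6) : Fin 3 :=
  if Gen.has (Gen.two (matching k 0)) q then 0 else
    if Gen.has (Gen.two (matching k 1)) q then 1 else 2

/-- The block of a colour with respect to the `k`-th triple. -/
def tripleBlock (k : Fin 10) (q : Fin 6) : Fin 2 :=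
  if (triplePerm k).symm q < 3 then 0 else 1

/-- Sorting the colours by blocks costs the sign of `pairPerm`, which `Gen.sgn` has put into the
complementary generator. -/
theorem word_pairBlock {n : ℕ} (i : Fin 15) (y : Fin 2 → Fin n) :
    word (fun q => y (pairBlock i q)) =
      colElem (y 0) (Gen.two i) * colElem (y 1) (Gen.four i) := by
  have h : ∀ i t, pairBlock i (pairPerm i t) = (![0, 0, 1, 1, 1, 1] : Fin 6 → Fin 2) t := by
    decide
  apply Subtype.ext
  rw [coe_word_perm _ (pairPerm i), Subalgebra.coe_mul, coe_colElem, coe_colElem, Gen.sgn,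
    Gen.sgn, one_smul, mul_smul_comm, ← mon_append]
  simp only [h]
  rfl

theorem word_matchBlock {n : ℕ} (k : Fin 15) (y : Fin 3 → Fin n) :
    word (fun q => y (matchBlock k q)) = (matchSign k : ℝ) •
      (colElem (y 0) (Gen.two (matching k 0)) * (colElem (y 1) (Gen.two (matching k 1)) *
        colElem (y 2) (Gen.two (matching k 2)))) := by
  have h : ∀ k t, matchBlock k (matchPerm k t) = (![0, 0, 1, 1, 2, 2] : Fin 6 → Fin 3) t := by
    decide
  apply Subtype.ext
  rw [coe_word_perm _ (matchPerm k), sign_matchPerm, Subalgebra.coe_smul, Subalgebra.coe_mul,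
    Subalgebra.coe_mul, coe_colElem, coe_colElem, coe_colElem, Gen.sgn, Gen.sgn, Gen.sgn,
    one_smul, one_smul, one_smul, ← mon_append, ← mon_append]
  simp only [h]
  rfl

theorem isColumn_colElem {n : ℕ} (j : Fin n) : IsColumn (ctop n) (avoid j) (colElem j) where
  map_eq_zero q z hz := ctop_eq_zero_of_mem_avoid hz
  mem_of_not_has v q h := colElem_mem_avoid (Or.inr h)
  mul_eq_zero v w q hv hw := by
    apply Subtype.ext
    rw [Subalgebra.coe_mul, coe_colElem, coe_colElem, smul_mul_smul_comm, ← mon_append,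
      mon_eq_zero_of_not_nodup, smul_zero]
    · rfl
    · intro hn
      rw [← Gen.mem_colors_iff] at hv hw
      exact (List.nodup_append.mp hn).2.2 _ (List.mem_map_of_mem (f := fun q => (j, q)) hv) _
        (List.mem_map_of_mem (f := fun q => (j, q)) hw) rfl
  two_mul_four i := by
    rw [← word_pairBlock i (fun _ => j), colElem_full]
  two_mul_two_mul_two k := by
    have h := word_matchBlock k (fun _ => j)
    rw [colElem_full, h, smul_smul, ← Int.cast_mul, matchSign_mul_self, Int.cast_one, one_smul]

theorem ctop_prod_full (n : ℕ) : ctop n (∏ j, colElem j Gen.full) = 1 := by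
  simp only [colElem_full]
  rw [ctop_prod_word]
  refine Finset.prod_eq_one fun q _ => ?_
  rw [show (Matrix.of fun j i : Fin n => if i = j then (1 : ℝ) else 0) = 1 by
    ext i j; simp [Matrix.one_apply, eq_comm], Matrix.det_one]

theorem ctop_aeval {n : ℕ} (Y : GenPoly) :
    ctop n (MvPolynomial.aeval (∑ j, colElem (n := n) j) Y) = topFunctional n Y := by
  have h := map_prod_mul_aeval (ctop n) avoid colElem isColumn_colElem
    (fun j q k v hk => colElem_mem_avoid (Or.inl hk)) Finset.univ Y
  simpa [ctop_prod_full] using h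

/-! ### Splittings into two triples, the source of the third moment factor. -/

theorem mon_mul_mon {n : ℕ} (l l' : List (Fin n × Fin 6)) :
    mon l * mon l' = (-1 : ℝ) ^ (l.length * l'.length) • (mon l' * mon l) := by
  induction l' with
  | nil => simp [mon_nil]
  | cons p l' ih =>
    rw [mon_cons, ← mul_assoc, extGen, mul_ι_eq, smul_mul_assoc, mul_assoc, ih, mul_smul_comm,
      smul_smul, mul_assoc, List.length_cons, ← pow_add]
    congr 2
    ring

/-- The product of two words with a common generator vanishes. -/
theorem word_mul_word_eq_zero {n : ℕ} {J J' : Fin 6 → Fin n} {q : Fin 6} (h : J q = J' q) :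
    word J * word J' = 0 := by
  apply Subtype.ext
  rw [Subalgebra.coe_mul, coe_word, coe_word, ← mon_append, mon_eq_zero_of_not_nodup]
  · rfl
  · intro hn
    have h1 : (J q, q) ∈ List.ofFn fun q => (J q, q) := List.mem_ofFn.mpr ⟨q, rfl⟩
    have h2 : (J q, q) ∈ List.ofFn fun q => (J' q, q) := List.mem_ofFn.mpr ⟨q, by rw [h]⟩
    exact (List.nodup_append.mp hn).2.2 _ h1 _ h2 rfl

theorem sum_fin_two_arrow {ι M : Type*} [Fintype ι] [AddCommMonoid M] (f : ι → ι → M) :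
    ∑ y : Fin 2 → ι, f (y 0) (y 1) = ∑ i, ∑ j, f i j := by
  exact (Fintype.sum_equiv (finTwoArrowEquiv ι) (fun y => f (y 0) (y 1)) (fun p => f p.1 p.2)
    (fun y => rfl)).trans (Fintype.sum_prod_type _)

/-- The sum of all words constant on the `k`-th triple of colours and on its complement. -/
def tripleSum (n : ℕ) (k : Fin 10) : ExtCenter n :=
  ∑ y : Fin 2 → Fin n, word fun q => y (tripleBlock k q)

theorem tripleBlock_perm : ∀ k t,
    tripleBlock k (triplePerm k t) = (![0, 0, 0, 1, 1, 1] : Fin 6 → Fin 2) t := by decide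

/-- The sum is, up to sign, a product of two elements of odd degree three, and an element of odd
degree anticommutes with itself, hence squares to zero. -/
theorem tripleSum_mul_self (n : ℕ) (k : Fin 10) : tripleSum n k * tripleSum n k = 0 := by
  set σ := triplePerm k
  set s : ℝ := ((Equiv.Perm.sign σ : ℤ) : ℝ)
  set d₀ : Fin n → Ext n := fun j => mon [(j, σ 0), (j, σ 1), (j, σ 2)] with hd₀
  set d₁ : Fin n → Ext n := fun j => mon [(j, σ 3), (j, σ 4), (j, σ 5)] with hd₁
  have hE : (tripleSum n k : Ext n) = s • ((∑ j, d₀ j) * ∑ j, d₁ j) := by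
    rw [tripleSum, AddSubmonoidClass.coe_finsetSum, Finset.sum_mul_sum, Finset.smul_sum]
    simp only [Finset.smul_sum]
    rw [← sum_fin_two_arrow fun i j => s • (d₀ i * d₁ j)]
    refine Finset.sum_congr rfl fun y _ => ?_
    rw [coe_word_perm _ σ, hd₀, hd₁]
    simp only [σ, tripleBlock_perm, ← mon_append]
    rfl
  have h0 : (∑ j, d₀ j) * ∑ j, d₀ j = 0 := by
    have h2 : (2 : ℝ) • ((∑ j, d₀ j) * ∑ j, d₀ j) = 0 → (∑ j, d₀ j) * ∑ j, d₀ j = 0 := fun h =>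
      (smul_eq_zero.mp h).resolve_left two_ne_zero
    apply h2
    rw [two_smul, add_eq_zero_iff_eq_neg]
    conv_lhs => rw [Finset.sum_mul_sum]
    conv_rhs => rw [Finset.sum_mul_sum, Finset.sum_comm]
    rw [← Finset.sum_neg_distrib]
    refine Finset.sum_congr rfl fun i _ => ?_
    rw [← Finset.sum_neg_distrib]
    refine Finset.sum_congr rfl fun j _ => ?_
    simp only [hd₀]
    have h9 : (-1 : ℝ) ^ ([(i, σ 0), (i, σ 1), (i, σ 2)].length *
        [(j, σ 0), (j, σ 1), (j, σ 2)].length) = -1 := Odd.neg_one_pow ⟨4, rfl⟩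
    rw [mon_mul_mon, h9, neg_one_smul]
  apply Subtype.ext
  rw [Subalgebra.coe_mul]
  have hc := Subalgebra.mem_center_iff.mp (tripleSum n k).2 (∑ j, d₀ j)
  have h3 : (tripleSum n k : Ext n) * tripleSum n k =
      s • ((tripleSum n k * ∑ j, d₀ j) * ∑ j, d₁ j) := by
    nth_rewrite 2 [hE]
    rw [mul_smul_comm, ← mul_assoc]
  rw [h3, ← hc, hE, mul_smul_comm, ← mul_assoc, h0]
  simp

/-- The automorphism changing the sign of all generators of a column. -/
def flip {n : ℕ} (j : Fin n) : Ext n →ₐ[ℝ] Ext n :=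
  ExteriorAlgebra.map (scale fun p => if p.1 = j then -1 else 1)

/-- A column has six generators, so the sign change has determinant `(-1) ^ 6 = 1`. -/
theorem top_flip {n : ℕ} (j : Fin n) (z : Ext n) : top n (flip j z) = top n z := by
  rw [flip, top_map, det_scale, Fintype.prod_prod_type, Finset.prod_eq_one, one_mul]
  intro i _
  dsimp only
  split_ifs <;> norm_num

theorem flip_colElem {n : ℕ} (j k : Fin n) (v : Gen) :
    flip j (colElem k v : Ext n) = colElem k v := by
  rw [coe_colElem, map_smul, flip, map_scale_mon, List.map_map, List.prod_eq_pow_card _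
    (if k = j then (-1 : ℝ) else 1)]
  · rw [List.length_map]
    split_ifs
    · rw [(Gen.even_length_colors v).neg_one_pow, one_smul]
    · rw [one_pow, one_smul]
  · intro x hx
    obtain ⟨q, _, rfl⟩ := List.mem_map.mp hx
    rfl

theorem flip_aeval {n : ℕ} (j : Fin n) (Y : GenPoly) :
    flip j (MvPolynomial.aeval (∑ j, colElem (n := n) j) Y : ExtCenter n) =
      (MvPolynomial.aeval (∑ j, colElem (n := n) j) Y : ExtCenter n) := by
  have h := aeval_mem_subalgebra ((AlgHom.equalizer (flip j) (AlgHom.id ℝ (Ext n))).comap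
    (Subalgebra.center ℝ (Ext n)).val) (∑ j, colElem (n := n) j) (fun v => by
      rw [Finset.sum_apply]
      exact Subalgebra.sum_mem _ fun k _ => flip_colElem j k v) Y
  exact h

theorem flip_word_tripleBlock {n : ℕ} (j : Fin n) (k : Fin 10) (y : Fin 2 → Fin n) :
    flip j (word fun q => y (tripleBlock k q) : ExtCenter n) =
      ((if y 0 = j then (-1 : ℝ) else 1) * (if y 1 = j then (-1 : ℝ) else 1)) •
        (word fun q => y (tripleBlock k q) : Ext n) := by
  rw [coe_word, flip, map_scale_mon, List.map_ofFn, List.prod_ofFn]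
  congr 1
  rw [← Equiv.prod_comp (triplePerm k)]
  simp only [Function.comp_apply, tripleBlock_perm, Fin.prod_univ_succ]
  simp
  by_cases h0 : y 0 = j <;> by_cases h1 : y 1 = j <;> simp [h0, h1]

/-- Elements on which the sign change of a column has no effect after multiplication by `w`. -/
structure FlipInvariant {n : ℕ} (j : Fin n) (w W : ExtCenter n) : Prop where
  mem_center : flip j (W : Ext n) ∈ Subalgebra.center ℝ (Ext n)
  mul_eq : (w : Ext n) * flip j (W : Ext n) = w * W

theorem FlipInvariant.mul {n : ℕ} {j : Fin n} {w W W' : ExtCenter n} (h : FlipInvariant j w W)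
    (h' : FlipInvariant j w W') : FlipInvariant j w (W * W') where
  mem_center := by
    rw [Subalgebra.coe_mul, map_mul]
    exact Subalgebra.mul_mem _ h.mem_center h'.mem_center
  mul_eq := by
    rw [Subalgebra.coe_mul, map_mul, ← mul_assoc, h.mul_eq,
      Subalgebra.mem_center_iff.mp W.2 (w : Ext n), mul_assoc, h'.mul_eq, ← mul_assoc, ← mul_assoc,
      Subalgebra.mem_center_iff.mp W.2 (w : Ext n)]

theorem FlipInvariant.prod {n : ℕ} {j : Fin n} {w : ExtCenter n} {ι : Type*} (s : Finset ι)
    (f : ι → ExtCenter n) (h : ∀ i ∈ s, FlipInvariant j w (f i)) :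
    FlipInvariant j w (∏ i ∈ s, f i) := by
  refine Finset.prod_induction f (FlipInvariant j w) (fun _ _ => FlipInvariant.mul) ?_ h
  refine ⟨?_, ?_⟩
  · rw [Subalgebra.coe_one, map_one]; exact Subalgebra.one_mem _
  · rw [Subalgebra.coe_one, map_one]

theorem FlipInvariant.aeval {n : ℕ} (j : Fin n) (w : ExtCenter n) (Y : GenPoly) :
    FlipInvariant j w (MvPolynomial.aeval (∑ j, colElem (n := n) j) Y) where
  mem_center := by rw [flip_aeval]; exact Subtype.prop _
  mul_eq := by rw [flip_aeval]

/-- For two different splittings, both blocks of `k'` meet the first block of `k`. A word of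
`tripleSum n k'` that uses column `y 0` therefore shares a generator with the given word and is
killed by it; the other words are unaffected by the flip. -/
theorem FlipInvariant.tripleSum {n : ℕ} {k k' : Fin 10} (h : k' ≠ k) (y : Fin 2 → Fin n) :
    FlipInvariant (y 0) (word fun q => y (tripleBlock k q)) (tripleSum n k') where
  mem_center := by
    rw [SixthMoment.tripleSum, AddSubmonoidClass.coe_finsetSum, map_sum]
    refine Subalgebra.sum_mem _ fun y' _ => ?_
    rw [flip_word_tripleBlock]
    exact Subalgebra.smul_mem _ (Subtype.prop _) _
  mul_eq := by
    rw [SixthMoment.tripleSum, AddSubmonoidClass.coe_finsetSum, map_sum, Finset.mul_sum,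
      Finset.mul_sum]
    refine Finset.sum_congr rfl fun y' _ => ?_
    have key : ∀ k k', k' ≠ k → ∀ b, ∃ q, tripleBlock k q = 0 ∧ tripleBlock k' q = b := by
      decide +kernel
    have hzero : ∀ b, y' b = y 0 → (word (fun q => y (tripleBlock k q)) : Ext n) *
        word (fun q => y' (tripleBlock k' q)) = 0 := by
      intro b hb
      obtain ⟨q, h0, h1⟩ := key k k' h b
      exact congrArg Subtype.val (word_mul_word_eq_zero
        (J := fun q => y (tripleBlock k q)) (J' := fun q => y' (tripleBlock k' q)) (q := q)
        (by simp only [h0, h1, hb]))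
    rw [flip_word_tripleBlock, mul_smul_comm]
    by_cases h0 : y' 0 = y 0
    · rw [hzero 0 h0, smul_zero]
    · by_cases h1 : y' 1 = y 0
      · rw [hzero 1 h1, smul_zero]
      · rw [if_neg h0, if_neg h1, mul_one, one_smul]

/-- Column `y 0` holds three generators of the word, so the flip negates the product while
preserving the top coefficient. -/
theorem ctop_word_tripleBlock_mul {n : ℕ} {k : Fin 10} {y : Fin 2 → Fin n} (hy : y 0 ≠ y 1)
    {W : ExtCenter n} (hW : FlipInvariant (y 0) (word fun q => y (tripleBlock k q)) W) :
    ctop n ((word fun q => y (tripleBlock k q)) * W) = 0 := by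
  change top n ((word fun q => y (tripleBlock k q) : Ext n) * W) = 0
  have h := top_flip (y 0) ((word fun q => y (tripleBlock k q) : Ext n) * W)
  rw [map_mul, flip_word_tripleBlock, if_pos rfl, if_neg hy.symm, smul_mul_assoc, hW.mul_eq,
    map_smul, smul_eq_mul] at h
  linarith

/-- Under the top coefficient, sums over split triples can be replaced by sums over full
columns. -/
theorem ctop_prod_tripleSum_mul {n : ℕ} (U : Finset (Fin 10)) (Y : GenPoly) :
    ctop n ((∏ k ∈ U, tripleSum n k) * MvPolynomial.aeval (∑ j, colElem (n := n) j) Y) =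
      topFunctional n (MvPolynomial.X Gen.full ^ U.card * Y) := by
  induction U using Finset.induction_on generalizing Y with
  | empty => rw [Finset.prod_empty, one_mul, ctop_aeval]; simp
  | insert k U hk ih =>
    rw [Finset.prod_insert hk, Finset.card_insert_of_notMem hk, pow_succ, mul_assoc, mul_assoc,
      ← ih, tripleSum, Finset.sum_mul, map_sum]
    -- Only the diagonal terms survive, and on the diagonal the word is a full column.
    have h1 : ∀ y : Fin 2 → Fin n, ctop n ((word fun q => y (tripleBlock k q)) *
        ((∏ k ∈ U, tripleSum n k) * MvPolynomial.aeval (∑ j, colElem (n := n) j) Y)) =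
        if y 0 = y 1 then ctop n (colElem (y 0) Gen.full *
          ((∏ k ∈ U, tripleSum n k) * MvPolynomial.aeval (∑ j, colElem (n := n) j) Y)) else 0 := by
      intro y
      split_ifs with hy
      · rw [colElem_full]
        congr 3
        funext q
        have : ∀ b, y b = y 0 := by
          intro b; fin_cases b
          · rfl
          · exact hy.symm
        exact this _
      · exact ctop_word_tripleBlock_mul hy ((FlipInvariant.prod _ _ fun k' hk' =>
          FlipInvariant.tripleSum (by rintro rfl; exact hk hk') y).mul (FlipInvariant.aeval _ _ _))
    rw [Finset.sum_congr rfl fun y _ => h1 y, sum_fin_two_arrow fun i i' =>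
      if i = i' then ctop n (colElem i Gen.full *
          ((∏ k ∈ U, tripleSum n k) * MvPolynomial.aeval (∑ j, colElem (n := n) j) Y)) else 0]
    simp only [Finset.sum_ite_eq, Finset.mem_univ, if_true]
    rw [← map_sum, ← Finset.sum_mul, map_mul (MvPolynomial.aeval _), MvPolynomial.aeval_X,
      Finset.sum_apply]
    congr 1
    ring

/-! ### The moment-cumulant formula on six colours. -/

section Kernel

variable {α : Type*} [DecidableEq α]

/-- The number of colours with a given image. -/
def fiberCard (J : Fin 6 → α) (v : α) : ℕ := (Finset.univ.filter fun q => J q = v).card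

/-- The product of the moments given by the fibres of `J`. -/
def fiberWeight [Fintype α] (m : ℕ → ℝ) (J : Fin 6 → α) : ℝ := ∏ v, m (fiberCard J v)

/-- Whether `J` is constant on the fibres of `π`, where `ρ` chooses an element of each fibre. -/
def Factors {β : Type*} (π : Fin 6 → β) (ρ : β → Fin 6) (J : Fin 6 → α) : Prop :=
  ∀ a, J a = J (ρ (π a))

instance {β : Type*} (π : Fin 6 → β) (ρ : β → Fin 6) (J : Fin 6 → α) :
    Decidable (Factors π ρ J) :=
  inferInstanceAs (Decidable (∀ a, J a = J (ρ (π a))))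

/-- A colour in each block of the `i`-th pair and its complement. -/
def pairRep (i : Fin 15) : Fin 2 → Fin 6 := ![pairColor i 0, complColor i 0]

/-- A colour in each block of the `k`-th triple and its complement. -/
def tripleRep (k : Fin 10) : Fin 2 → Fin 6 := ![triplePerm k 0, triplePerm k 3]

/-- A colour in each block of the `k`-th perfect matching. -/
def matchRep (k : Fin 15) : Fin 3 → Fin 6 := fun t => pairColor (matching k t) 0

/-- The numbers of partitions with given block sizes that refine the kernel of `J`. -/
structure RefineCounts (J : Fin 6 → α) (a b c d : ℕ) : Prop where
  const : (if Factors (fun _ => (0 : Fin 1)) (fun _ => 0) J then 1 else 0) = a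
  pair : (∑ i, if Factors (pairBlock i) (pairRep i) J then 1 else 0) = b
  triple : (∑ i, if Factors (tripleBlock i) (tripleRep i) J then 1 else 0) = c
  matching : (∑ i, if Factors (matchBlock i) (matchRep i) J then 1 else 0) = d

instance (J : Fin 6 → α) (a b c d : ℕ) : Decidable (RefineCounts J a b c d) :=
  decidable_of_iff (((if Factors (fun _ => (0 : Fin 1)) (fun _ => 0) J then 1 else 0) = a ∧
    (∑ i, if Factors (pairBlock i) (pairRep i) J then 1 else 0) = b) ∧
    (∑ i, if Factors (tripleBlock i) (tripleRep i) J then 1 else 0) = c ∧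
    (∑ i, if Factors (matchBlock i) (matchRep i) J then 1 else 0) = d)
    ⟨fun h => ⟨h.1.1, h.1.2, h.2.1, h.2.2⟩, fun h => ⟨⟨h.1, h.2⟩, h.3, h.4⟩⟩

end Kernel

/-- The possible fibre cardinalities of `J` and the corresponding refinement counts. -/
def KernelType (J : Fin 6 → Fin 6) : Prop :=
  ((∃ u, fiberCard J u = 1) ∧ RefineCounts J 0 0 0 0) ∨
  ((∃ u, fiberCard J u = 6 ∧ ∀ w, w ≠ u → fiberCard J w = 0) ∧ RefineCounts J 1 15 10 15) ∨
  ((∃ u v, u ≠ v ∧ fiberCard J u = 4 ∧ fiberCard J v = 2 ∧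
    ∀ w, w ≠ u → w ≠ v → fiberCard J w = 0) ∧ RefineCounts J 0 1 0 3) ∨
  ((∃ u v, u ≠ v ∧ fiberCard J u = 3 ∧ fiberCard J v = 3 ∧
    ∀ w, w ≠ u → w ≠ v → fiberCard J w = 0) ∧ RefineCounts J 0 0 1 0) ∨
  ((∃ u v w, u ≠ v ∧ u ≠ w ∧ v ≠ w ∧ fiberCard J u = 2 ∧ fiberCard J v = 2 ∧ fiberCard J w = 2 ∧
    ∀ z, z ≠ u → z ≠ v → z ≠ w → fiberCard J z = 0) ∧ RefineCounts J 0 0 0 1)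

instance (J : Fin 6 → Fin 6) : Decidable (KernelType J) := by
  unfold KernelType
  infer_instance

/-- A partition of the colours is encoded by the map sending each colour to the least one in its
block, that is, an idempotent `r` with `r q ≤ q`. This leaves at most `6!` candidates to check. -/
theorem kernelType_of_le : ∀ (a : Fin 2) (b : Fin 3) (c : Fin 4) (d : Fin 5) (e : Fin 6),
    (∀ q, (![0, ⟨a, by omega⟩, ⟨b, by omega⟩, ⟨c, by omega⟩, ⟨d, by omega⟩, e] : Fin 6 → Fin 6)
      ((![0, ⟨a, by omega⟩, ⟨b, by omega⟩, ⟨c, by omega⟩, ⟨d, by omega⟩, e] : Fin 6 → Fin 6) q) =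
      (![0, ⟨a, by omega⟩, ⟨b, by omega⟩, ⟨c, by omega⟩, ⟨d, by omega⟩, e] : Fin 6 → Fin 6) q) →
    KernelType ![0, ⟨a, by omega⟩, ⟨b, by omega⟩, ⟨c, by omega⟩, ⟨d, by omega⟩, e] := by
  decide +kernel

section Kernel

variable {α : Type*} [DecidableEq α]

/-- The first colour with the same image. -/
def firstColor (J : Fin 6 → α) (q : Fin 6) : Fin 6 :=
  (Finset.univ.filter fun a => J a = J q).min' ⟨q, by simp⟩

theorem apply_firstColor (J : Fin 6 → α) (q : Fin 6) : J (firstColor J q) = J q := by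
  have := Finset.min'_mem (Finset.univ.filter fun a => J a = J q) ⟨q, by simp⟩
  exact (Finset.mem_filter.mp this).2

theorem firstColor_le (J : Fin 6 → α) (q : Fin 6) : firstColor J q ≤ q :=
  Finset.min'_le _ _ (by simp)

theorem firstColor_eq_iff (J : Fin 6 → α) (a b : Fin 6) :
    firstColor J a = firstColor J b ↔ J a = J b := by
  constructor
  · intro h
    rw [← apply_firstColor J a, h, apply_firstColor J]
  · intro h
    simp only [firstColor, h]

theorem firstColor_firstColor (J : Fin 6 → α) (q : Fin 6) :
    firstColor J (firstColor J q) = firstColor J q := by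
  rw [firstColor_eq_iff, apply_firstColor J]

theorem kernelType_firstColor (J : Fin 6 → α) : KernelType (firstColor J) := by
  set r := firstColor J with hr
  have hle : ∀ q, r q ≤ q := firstColor_le J
  have hv : ∀ q, (r q : ℕ) ≤ q := hle
  have h := kernelType_of_le ⟨r 1, Nat.lt_succ_of_le (hv 1)⟩ ⟨r 2, Nat.lt_succ_of_le (hv 2)⟩
    ⟨r 3, Nat.lt_succ_of_le (hv 3)⟩ ⟨r 4, Nat.lt_succ_of_le (hv 4)⟩ (r 5)
  have hreq : (![0, r 1, r 2, r 3, r 4, r 5] : Fin 6 → Fin 6) = r := by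
    funext q
    fin_cases q
    · exact (Fin.le_zero_iff.mp (hle 0)).symm
    all_goals rfl
  simp only [Fin.eta, hreq] at h
  exact h (firstColor_firstColor J)

theorem factors_firstColor {β : Type*} (π : Fin 6 → β) (ρ : β → Fin 6) (J : Fin 6 → α) :
    Factors π ρ (firstColor J) ↔ Factors π ρ J := by
  simp only [Factors, firstColor_eq_iff]

theorem fiberWeight_eq_prod_image [Fintype α] (m : ℕ → ℝ) (h0 : m 0 = 1) (J : Fin 6 → α) :
    fiberWeight m J = ∏ v ∈ Finset.univ.image J, m (fiberCard J v) := by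
  refine (Finset.prod_subset (Finset.subset_univ _) fun v _ hv => ?_).symm
  have : fiberCard J v = 0 := by
    rw [fiberCard, Finset.card_eq_zero, Finset.filter_eq_empty_iff]
    rintro q - rfl
    exact hv (Finset.mem_image_of_mem _ (Finset.mem_univ q))
  rw [this, h0]

/-- Both maps have the same fibres, and empty fibres contribute `m 0 = 1`; this reduces the formula
to the finitely many canonical maps. -/
theorem fiberWeight_firstColor [Fintype α] (m : ℕ → ℝ) (h0 : m 0 = 1) (J : Fin 6 → α) :
    fiberWeight m (firstColor J) = fiberWeight m J := by
  have h1 : (Finset.univ.image (firstColor J)).image J = Finset.univ.image J := by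
    rw [Finset.image_image]
    congr 1
    funext q
    exact apply_firstColor J q
  symm
  rw [fiberWeight_eq_prod_image m h0 J, ← h1, Finset.prod_image,
    fiberWeight_eq_prod_image m h0 (firstColor J)]
  · refine Finset.prod_congr rfl fun u hu => ?_
    obtain ⟨a, -, rfl⟩ := Finset.mem_image.mp hu
    simp only [fiberCard, firstColor_eq_iff, apply_firstColor J]
  · intro u hu v hv huv
    obtain ⟨a, -, rfl⟩ := Finset.mem_image.mp hu
    obtain ⟨b, -, rfl⟩ := Finset.mem_image.mp hv
    rw [apply_firstColor J, apply_firstColor J] at huv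
    exact (firstColor_eq_iff J a b).mpr huv

/-- The moment-cumulant formula for six factors with mean zero and unit variance. -/
theorem fiberWeight_eq [Fintype α] (m : ℕ → ℝ) (h0 : m 0 = 1) (h1 : m 1 = 0) (h2 : m 2 = 1)
    (J : Fin 6 → α) : fiberWeight m J =
      (m 6 - 10 * m 3 ^ 2 - 15 * m 4 + 30) *
        (if Factors (fun _ => (0 : Fin 1)) (fun _ => 0) J then 1 else 0) +
      (m 4 - 3) * (∑ i, if Factors (pairBlock i) (pairRep i) J then 1 else 0) +
      m 3 ^ 2 * (∑ k, if Factors (tripleBlock k) (tripleRep k) J then 1 else 0) +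
      ∑ k, if Factors (matchBlock k) (matchRep k) J then 1 else 0 := by
  rw [← fiberWeight_firstColor m h0 J]
  simp only [← factors_firstColor _ _ J]
  have hcast : ∀ {a b c d : ℕ}, RefineCounts (firstColor J) a b c d →
      (m 6 - 10 * m 3 ^ 2 - 15 * m 4 + 30) *
        (if Factors (fun _ => (0 : Fin 1)) (fun _ => 0) (firstColor J) then 1 else 0) +
      (m 4 - 3) * (∑ i, if Factors (pairBlock i) (pairRep i) (firstColor J) then 1 else 0) +
      m 3 ^ 2 * (∑ k, if Factors (tripleBlock k) (tripleRep k) (firstColor J) then 1 else 0) +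
      (∑ k, if Factors (matchBlock k) (matchRep k) (firstColor J) then (1 : ℝ) else 0) =
      (m 6 - 10 * m 3 ^ 2 - 15 * m 4 + 30) * a + (m 4 - 3) * b + m 3 ^ 2 * c + d := by
    intro a b c d h
    rw [← h.const, ← h.pair, ← h.triple, ← h.matching]
    push_cast
    rfl
  have hk := kernelType_firstColor J
  have hprod : ∀ s : Finset (Fin 6), (∀ w, w ∉ s → fiberCard (firstColor J) w = 0) →
      fiberWeight m (firstColor J) = ∏ v ∈ s, m (fiberCard (firstColor J) v) := by
    intro s hs
    refine (Finset.prod_subset (Finset.subset_univ _) fun v _ hv => ?_).symm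
    rw [hs v hv, h0]
  -- The cases are a singleton fibre, then fibre sizes 6, 4+2, 3+3 and 2+2+2. For size 6 the
  -- identity is `κ₆ + 15 κ₄ + 10 m₃² + 15 = m₆`; for 4+2 it is `κ₄ + 3 = m₄`.
  rcases hk with ⟨⟨u, hu⟩, hc⟩ | ⟨⟨u, hu, hw⟩, hc⟩ | ⟨⟨u, v, huv, hu, hv, hw⟩, hc⟩ |
    ⟨⟨u, v, huv, hu, hv, hw⟩, hc⟩ | ⟨⟨u, v, w, huv, huw, hvw, hu, hv, hw, hz⟩, hc⟩
  · rw [hcast hc, fiberWeight, Finset.prod_eq_zero (Finset.mem_univ u) (by rw [hu, h1])]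
    simp
  · rw [hcast hc, hprod {u} (by simpa using hw), Finset.prod_singleton, hu]
    push_cast
    ring
  · rw [hcast hc, hprod {u, v} (by simpa using hw), Finset.prod_pair huv, hu, hv, h2]
    push_cast
    ring
  · rw [hcast hc, hprod {u, v} (by simpa using hw), Finset.prod_pair huv, hu, hv]
    push_cast
    ring
  · rw [hcast hc, hprod {u, v, w} (by simpa using hz), Finset.prod_insert (by simp [huv, huw]),
      Finset.prod_pair hvw, hu, hv, hw, h2]
    push_cast
    ring

end Kernel

theorem sum_factors_smul {n : ℕ} {β M : Type*} [Fintype β] [DecidableEq β] [AddCommMonoid M]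
    [Module ℝ M] (π : Fin 6 → β) (ρ : β → Fin 6) (h : ∀ b, π (ρ b) = b) (g : (Fin 6 → Fin n) → M) :
    ∑ J : Fin 6 → Fin n, (if Factors π ρ J then (1 : ℝ) else 0) • g J =
      ∑ y : β → Fin n, g fun q => y (π q) := by
  simp only [ite_smul, one_smul, zero_smul]
  rw [← Finset.sum_filter]
  refine Finset.sum_bij' (fun J _ => fun b => J (ρ b)) (fun y _ => fun q => y (π q)) ?_ ?_ ?_ ?_ ?_
  · simp
  · intro y _
    exact Finset.mem_filter.mpr ⟨Finset.mem_univ _, fun a => by simp only [h]⟩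
  · intro J hJ
    funext q
    exact ((Finset.mem_filter.mp hJ).2 q).symm
  · intro y _
    funext b
    simp only [h]
  · intro J hJ
    congr 1
    funext q
    exact (Finset.mem_filter.mp hJ).2 q

/-! ### From tables to top coefficients and generating functions. -/

theorem genPf_eq_sum_smul : genPf = ∑ k, (matchSign k : ℝ) •
    (MvPolynomial.X (Gen.two (matching k 0)) * (MvPolynomial.X (Gen.two (matching k 1)) *
      MvPolynomial.X (Gen.two (matching k 2)))) := by
  rw [genPf, pfaffian]
  refine Finset.sum_congr rfl fun k _ => ?_
  rw [Int.cast_smul_eq_zsmul, zsmul_eq_mul, mul_assoc (MvPolynomial.X _)]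

/-- The polynomial of a row with vanishing third moment. -/
def rowPoly (κ₄ κ₆ : ℝ) : GenPoly := κ₆ • MvPolynomial.X Gen.full + (κ₄ • genCross + genPf)

theorem sum_fiberWeight_smul_word {n : ℕ} (m : ℕ → ℝ) (h0 : m 0 = 1) (h1 : m 1 = 0)
    (h2 : m 2 = 1) :
    ∑ J : Fin 6 → Fin n, fiberWeight m J • word J =
      MvPolynomial.aeval (∑ j, colElem (n := n) j)
        (rowPoly (m 4 - 3) (m 6 - 10 * m 3 ^ 2 - 15 * m 4 + 30)) +
      m 3 ^ 2 • ∑ k, tripleSum n k := by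
  have hp : ∀ i b, pairBlock i (pairRep i b) = b := by decide
  have ht : ∀ k b, tripleBlock k (tripleRep k b) = b := by decide
  have hm : ∀ k b, matchBlock k (matchRep k b) = b := by decide
  have hc : ∑ y : Fin 1 → Fin n, word (fun _ => y 0) = ∑ j, colElem j Gen.full := by
    simp only [colElem_full]
    exact Fintype.sum_equiv (Equiv.funUnique (Fin 1) (Fin n)) _ _ fun y => rfl
  have h3 : ∀ i : Fin 15, ∑ y : Fin 2 → Fin n, word (fun q => y (pairBlock i q)) =
      (∑ j, colElem j (Gen.two i)) * ∑ j, colElem j (Gen.four i) := by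
    intro i
    simp only [word_pairBlock]
    rw [sum_fin_two_arrow fun a b => colElem (n := n) a (Gen.two i) * colElem b (Gen.four i),
      Finset.sum_mul_sum]
  have h4 : ∀ k : Fin 15, ∑ y : Fin 3 → Fin n, word (fun q => y (matchBlock k q)) =
      (matchSign k : ℝ) • ((∑ j, colElem j (Gen.two (matching k 0))) *
        ((∑ j, colElem j (Gen.two (matching k 1))) *
          ∑ j, colElem j (Gen.two (matching k 2)))) := by
    intro k
    simp only [word_matchBlock]
    rw [← Finset.smul_sum]
    congr 1
    have h5 := Finset.prod_univ_sum (fun _ : Fin 3 => (Finset.univ : Finset (Fin n)))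
      (fun t j => colElem (n := n) j (Gen.two (matching k t)))
    simp only [Fin.prod_univ_three, Fintype.piFinset_univ] at h5
    rw [← mul_assoc, h5]
    simp only [mul_assoc]
  simp only [fiberWeight_eq m h0 h1 h2, add_smul, mul_smul, Finset.sum_smul,
    Finset.sum_add_distrib, ← Finset.smul_sum]
  rw [Finset.sum_comm (f := fun (J : Fin 6 → Fin n) i =>
      (if Factors (pairBlock i) (pairRep i) J then (1 : ℝ) else 0) • word J),
    Finset.sum_comm (f := fun (J : Fin 6 → Fin n) k =>
      (if Factors (tripleBlock k) (tripleRep k) J then (1 : ℝ) else 0) • word J),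
    Finset.sum_comm (f := fun (J : Fin 6 → Fin n) k =>
      (if Factors (matchBlock k) (matchRep k) J then (1 : ℝ) else 0) • word J)]
  simp only [sum_factors_smul (pairBlock _) (pairRep _) (hp _),
    sum_factors_smul (tripleBlock _) (tripleRep _) (ht _),
    sum_factors_smul (matchBlock _) (matchRep _) (hm _)]
  rw [sum_factors_smul (fun _ => (0 : Fin 1)) (fun _ => 0) (fun b => (Subsingleton.elim _ _))]
  simp only [h3, h4, hc, rowPoly, map_add, map_smul, MvPolynomial.aeval_X, genCross,
    genPf_eq_sum_smul, map_sum, map_mul, Finset.sum_apply, tripleSum]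
  module

/-- The sum of the signed weights of all tables with six rows. -/
def tableSum (m : ℕ → ℝ) (n : ℕ) : ℝ := ∑ T : Table 6 n, T.sgn * T.weight m

/-- The factors of the `n`-th power are the columns of the table, while the columns of the exterior
algebra are the numbers in it. The top coefficient of a product of words is a product of six 0/1
determinants, which forces each row to be a permutation and contributes its sign. -/
theorem tableSum_eq_ctop (m : ℕ → ℝ) (n : ℕ) :
    tableSum m n = ctop n ((∑ J : Fin 6 → Fin n, fiberWeight m J • word J) ^ n) := by
  have h1 : (∑ J : Fin 6 → Fin n, fiberWeight m J • word J) ^ n =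
      ∑ W : Fin n → Fin 6 → Fin n, (∏ i, fiberWeight m (W i)) • ∏ i, word (W i) := by
    have h := Finset.prod_univ_sum (fun _ : Fin n => (Finset.univ : Finset (Fin 6 → Fin n)))
      (fun _ J => fiberWeight m J • word J)
    rw [Finset.prod_const, Finset.card_univ, Fintype.card_fin] at h
    simp only [Fintype.piFinset_univ, Finset.prod_smul] at h
    exact h
  have h2 : ∀ W : Fin n → Fin 6 → Fin n, ctop n (∏ i, word (W i)) =
      ∑ T : Table 6 n, T.sgn * if W = fun i q => T q i then 1 else 0 := by
    intro W
    rw [ctop_prod_word]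
    simp only [Matrix.det_apply', Matrix.of_apply]
    have h := Finset.prod_univ_sum (fun _ : Fin 6 => (Finset.univ : Finset (Equiv.Perm (Fin n))))
      (fun q σ => ((Equiv.Perm.sign σ : ℤ) : ℝ) * ∏ i, if W i q = σ i then (1 : ℝ) else 0)
    rw [h, Fintype.piFinset_univ]
    refine Finset.sum_congr rfl fun T _ => ?_
    rw [Finset.prod_mul_distrib, Table.sgn]
    congr 1
    simp only [Finset.prod_ite_zero, Finset.prod_const_one, Finset.mem_univ, true_imp_iff]
    congr 1
    rw [eq_iff_iff, funext_iff]
    simp only [funext_iff]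
    exact forall_comm
  rw [h1, map_sum]
  simp only [map_smul, smul_eq_mul, h2, Finset.mul_sum]
  rw [Finset.sum_comm, tableSum]
  refine Finset.sum_congr rfl fun T _ => ?_
  simp only [mul_ite, mul_one, mul_zero]
  rw [Finset.sum_ite_eq' Finset.univ (fun i q => T q i), if_pos (Finset.mem_univ _), mul_comm]
  rfl

/-- Since each `tripleSum` squares to zero, a further factor can only add one of the `10 - U.card`
splittings not yet used; the set `U` of used ones makes the induction work. -/
theorem ctop_tripleSum_pow_mul {n : ℕ} (r : ℕ) (U : Finset (Fin 10)) (Y : GenPoly) :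
    ctop n ((∑ k, tripleSum n k) ^ r * ((∏ k ∈ U, tripleSum n k) *
      MvPolynomial.aeval (∑ j, colElem (n := n) j) Y)) =
      (10 - U.card).descFactorial r *
        topFunctional n (MvPolynomial.X Gen.full ^ (r + U.card) * Y) := by
  induction r generalizing U with
  | zero => rw [pow_zero, one_mul, ctop_prod_tripleSum_mul]; simp
  | succ r ih =>
    have h1 : (∑ k, tripleSum n k) * ∏ k ∈ U, tripleSum n k =
        ∑ k ∈ Uᶜ, ∏ l ∈ insert k U, tripleSum n l := by
      rw [Finset.sum_mul, ← Finset.sum_compl_add_sum U, Finset.sum_eq_zero (s := U), add_zero]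
      · refine Finset.sum_congr rfl fun k hk => ?_
        rw [Finset.prod_insert (Finset.mem_compl.mp hk)]
      · intro k hk
        rw [← Finset.mul_prod_erase U _ hk, ← mul_assoc, tripleSum_mul_self, zero_mul]
    rw [pow_succ, mul_assoc, ← mul_assoc (∑ k, tripleSum n k), h1, Finset.sum_mul,
      Finset.mul_sum, map_sum, Finset.sum_congr rfl fun k _ => ih (insert k U),
      Finset.sum_congr (g := fun _ => ((10 - U.card - 1).descFactorial r : ℝ) *
        topFunctional n (MvPolynomial.X Gen.full ^ (r + 1 + U.card) * Y)) rfl]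
    · rw [Finset.sum_const, Finset.card_compl, Fintype.card_fin, nsmul_eq_mul, ← mul_assoc]
      congr 1
      rcases Nat.eq_zero_or_pos (10 - U.card) with h | h
      · simp [h]
      · obtain ⟨c, hc⟩ := Nat.exists_eq_succ_of_ne_zero h.ne'
        rw [hc, Nat.succ_sub_one, Nat.succ_descFactorial_succ]
        push_cast
        ring
    · intro k hk
      rw [Finset.card_insert_of_notMem (Finset.mem_compl.mp hk), Nat.sub_sub]
      congr 4
      ring

theorem topFunctional_X_full_pow_mul (r n : ℕ) (Y : GenPoly) :
    topFunctional (r + n) (MvPolynomial.X Gen.full ^ r * Y) =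
      (r + n).descFactorial r * topFunctional n Y := by
  induction r with
  | zero => simp
  | succ r ih =>
    rw [show r + 1 + n = r + n + 1 by ring, pow_succ', mul_assoc, topFunctional_X_full_mul, ih,
      Nat.succ_descFactorial_succ]
    push_cast
    ring

/-- With `n = r + k`, the factor `n.choose r * n.descFactorial r / (n!)²` equals `1 / (r! * (k!)²)`.
-/
theorem genFun_eq_mul {a b c : ℕ → ℝ} (h : ∀ n, a n = ∑ p ∈ Finset.HasAntidiagonal.antidiagonal n,
    (n.choose p.1 : ℝ) * n.descFactorial p.1 * c p.1 * b p.2) :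
    genFun a = PowerSeries.mk (fun r => c r / r.factorial) * genFun b := by
  ext n
  rw [PowerSeries.coeff_mul, genFun, PowerSeries.coeff_mk, h, Finset.sum_div]
  refine Finset.sum_congr rfl fun p hp => ?_
  rw [PowerSeries.coeff_mk, genFun, PowerSeries.coeff_mk]
  obtain ⟨r, k⟩ := p
  rw [Finset.HasAntidiagonal.mem_antidiagonal] at hp
  subst hp
  have h1 := Nat.add_choose_mul_factorial_mul_factorial r k
  have h2 : (r + k).descFactorial r * k.factorial = (r + k).factorial := by
    have := Nat.factorial_mul_descFactorial (Nat.le_add_right r k)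
    rw [Nat.add_sub_cancel_left] at this
    rw [mul_comm, this]
  have h1' : ((r + k).choose r : ℝ) * r.factorial * k.factorial = (r + k).factorial := by
    rw [Nat.choose_symm_add]
    exact_mod_cast h1
  have h2' : ((r + k).descFactorial r : ℝ) * k.factorial = (r + k).factorial := by
    exact_mod_cast h2
  have hr : (r.factorial : ℝ) ≠ 0 := by positivity
  have hk : (k.factorial : ℝ) ≠ 0 := by positivity
  have hrk : ((r + k).factorial : ℝ) ≠ 0 := by positivity
  rw [div_mul_div_comm, div_eq_div_iff (by positivity) (by positivity)]
  simp only
  linear_combination (((r + k).descFactorial r : ℝ) * c r * b k * k.factorial) * h1' +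
    (c r * b k * (r + k).factorial) * h2'

theorem genFun_tableSum (m : ℕ → ℝ) (h0 : m 0 = 1) (h1 : m 1 = 0) (h2 : m 2 = 1) :
    genFun (tableSum m) = (1 + C (m 3 ^ 2) * X) ^ 10 *
      genFun fun n => topFunctional n
        (rowPoly (m 4 - 3) (m 6 - 10 * m 3 ^ 2 - 15 * m 4 + 30) ^ n) := by
  -- `(10).descFactorial r` counts ordered choices of distinct splittings; divided by `r!` it is a
  -- binomial coefficient of the tenth power.
  rw [genFun_eq_mul (a := tableSum m) (c := fun r => (10).descFactorial r * (m 3 ^ 2) ^ r)]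
  · congr 1
    ext r
    rw [PowerSeries.coeff_mk, add_comm, Commute.add_pow (Commute.all _ _), map_sum]
    have : ∀ i, coeff r ((C (m 3 ^ 2) * X) ^ i * 1 ^ (10 - i) * ((10).choose i : ℝ⟦X⟧)) =
        if r = i then (m 3 ^ 2) ^ i * (10).choose i else 0 := by
      intro i
      rw [one_pow, mul_one, mul_pow, ← map_pow, ← map_natCast (C (R := ℝ)), mul_right_comm,
        ← map_mul, PowerSeries.coeff_C_mul, PowerSeries.coeff_X_pow]
      simp
    simp only [this, Finset.sum_ite_eq, Finset.mem_range]
    rw [Nat.descFactorial_eq_factorial_mul_choose]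
    have hr : (r.factorial : ℝ) ≠ 0 := by positivity
    split_ifs with h
    · push_cast
      field_simp
    · rw [Nat.choose_eq_zero_of_lt (by omega)]
      simp
  · intro n
    rw [tableSum_eq_ctop, sum_fiberWeight_smul_word m h0 h1 h2, add_comm,
      Commute.add_pow' (Commute.all _ _), map_sum]
    refine Finset.sum_congr rfl fun p hp => ?_
    obtain ⟨r, k⟩ := p
    rw [Finset.HasAntidiagonal.mem_antidiagonal] at hp
    subst hp
    simp only
    have h3 := ctop_tripleSum_pow_mul (n := r + k) r ∅
      (rowPoly (m 4 - 3) (m 6 - 10 * m 3 ^ 2 - 15 * m 4 + 30) ^ k)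
    rw [Finset.prod_empty, one_mul, Finset.card_empty, Nat.sub_zero, add_zero,
      topFunctional_X_full_pow_mul] at h3
    rw [map_nsmul, smul_pow, smul_mul_assoc, map_smul, ← map_pow, h3, nsmul_eq_mul, smul_eq_mul]
    ring

/-! ### Closed form of the part made of 4+2 and 2+2+2 blocks. -/

/-- The generating function of the contributions of pairs and their complements. -/
def crossFun (κ : ℝ) : ℝ⟦X⟧ := genFun fun n => topFunctional n ((κ • genCross + genPf) ^ n)

theorem genFun_rowPoly (κ₄ κ₆ : ℝ) :
    genFun (fun n => topFunctional n (rowPoly κ₄ κ₆ ^ n)) =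
      rescale κ₆ (exp ℝ) * crossFun κ₄ := by
  rw [crossFun, genFun_eq_mul (c := fun r => κ₆ ^ r)]
  · congr 1
    ext r
    rw [PowerSeries.coeff_mk, PowerSeries.coeff_rescale, PowerSeries.coeff_exp]
    simp [div_eq_mul_inv]
  · intro n
    rw [rowPoly, Commute.add_pow' (Commute.all _ _), topFunctional_sum]
    refine Finset.sum_congr rfl fun p hp => ?_
    obtain ⟨r, k⟩ := p
    rw [Finset.HasAntidiagonal.mem_antidiagonal] at hp
    subst hp
    simp only
    rw [smul_pow, smul_mul_assoc, ← Nat.cast_smul_eq_nsmul ℝ, topFunctional_smul,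
      topFunctional_smul, topFunctional_X_full_pow_mul]
    ring

/-- The rising factorial of `15 + 3N` becomes `k!` times a binomial coefficient, so the first two
factors form the coefficient of `t ^ k` in `(1 - κ t) ^ (-(15 + 3N))`. -/
theorem coeff_crossFun (κ : ℝ) (n : ℕ) : coeff n (crossFun κ) =
    ∑ p ∈ Finset.HasAntidiagonal.antidiagonal n, κ ^ p.1 * ((14 + 3 * p.2 + p.1).choose p.1 : ℝ) *
      ((1 + p.2) * (2 + p.2) * ((4 + p.2).factorial : ℝ) / 48) := by
  rw [crossFun, genFun, PowerSeries.coeff_mk, Commute.add_pow' (Commute.all _ _),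
    topFunctional_sum, Finset.sum_div]
  refine Finset.sum_congr rfl fun p hp => ?_
  obtain ⟨k, N⟩ := p
  rw [Finset.HasAntidiagonal.mem_antidiagonal] at hp
  subst hp
  simp only
  rw [smul_pow, smul_mul_assoc, ← Nat.cast_smul_eq_nsmul ℝ, topFunctional_smul,
    topFunctional_smul]
  have h1 := topFunctional_cross_pow_mul_genPf_pow k N
  have h2 := topFunctional_genPf_pow N
  rw [Nat.ascFactorial_eq_factorial_mul_choose', show 15 + 3 * N + k - 1 = 14 + 3 * N + k by omega]
    at h1
  have h3 : ((k + N).choose k : ℝ) * k.factorial * N.factorial = (k + N).factorial := by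
    rw [Nat.choose_symm_add]
    exact_mod_cast Nat.add_choose_mul_factorial_mul_factorial k N
  have hk : (k.factorial : ℝ) ≠ 0 := by positivity
  have hN : (N.factorial : ℝ) ≠ 0 := by positivity
  have hkN : ((k + N).factorial : ℝ) ≠ 0 := by positivity
  have h4 : ((N + 2).factorial : ℝ) = (N + 2) * (N + 1) * N.factorial := by
    rw [Nat.factorial_succ, Nat.factorial_succ]; push_cast; ring
  rw [h4] at h2
  push_cast at h1
  rw [add_comm 4 N]
  have e1 : topFunctional (k + N) (genCross ^ k * genPf ^ N) =
      (k + N).factorial * (k.factorial * ((14 + 3 * N + k).choose k : ℝ)) *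
        topFunctional N (genPf ^ N) / N.factorial := by
    rw [eq_div_iff hN, h1]
  have e2 : topFunctional N (genPf ^ N) =
      N.factorial * ((N + 2) * (N + 1) * N.factorial) * (N + 4).factorial / 48 := by
    rw [eq_div_iff (by norm_num), h2]
  have e3 : ((k + N).choose k : ℝ) = (k + N).factorial / (k.factorial * N.factorial) := by
    rw [eq_div_iff (by positivity), ← h3]; ring
  rw [e1, e2, e3]
  field_simp
  ring

theorem inv_linear_eq (m₄ : ℝ) :
    (1 + 3 * X - C m₄ * X : ℝ⟦X⟧)⁻¹ = rescale (m₄ - 3) (PowerSeries.mk 1) := by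
  symm
  rw [PowerSeries.eq_inv_iff_mul_eq_one (by simp)]
  have h := congrArg (rescale (m₄ - 3)) (PowerSeries.mk_one_mul_one_sub_eq_one ℝ)
  rw [map_mul, map_sub, map_one, PowerSeries.rescale_X, map_sub] at h
  rw [show (C (3 : ℝ) : ℝ⟦X⟧) = 3 from map_ofNat _ 3] at h
  linear_combination h

theorem coeff_inv_linear_pow (m₄ : ℝ) (d k : ℕ) :
    coeff k ((1 + 3 * X - C m₄ * X : ℝ⟦X⟧)⁻¹ ^ (d + 1)) =
      (m₄ - 3) ^ k * ((d + k).choose k : ℝ) := by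
  rw [inv_linear_eq, ← map_pow, PowerSeries.mk_one_pow_eq_mk_choose_add, PowerSeries.coeff_rescale,
    PowerSeries.coeff_mk, Nat.choose_symm_add]

theorem crossFun_eq (m₄ : ℝ) : crossFun (m₄ - 3) =
    (48 * (1 + 3 * X - C m₄ * X) ^ 15 : ℝ⟦X⟧)⁻¹ * summandSum m₄ := by
  have hinv : (48 * (1 + 3 * X - C m₄ * X) ^ 15 : ℝ⟦X⟧)⁻¹ =
      C (1 / 48) * (1 + 3 * X - C m₄ * X : ℝ⟦X⟧)⁻¹ ^ 15 := by
    have hc : constantCoeff (1 + 3 * X - C m₄ * X : ℝ⟦X⟧) ≠ 0 := by simp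
    have h48 : constantCoeff (48 : ℝ⟦X⟧) = 48 := map_ofNat _ 48
    symm
    rw [PowerSeries.eq_inv_iff_mul_eq_one (by simp [h48])]
    have h1 : (C (1 / 48 : ℝ) : ℝ⟦X⟧) * 48 = 1 := by
      rw [show (48 : ℝ⟦X⟧) = C 48 from (map_ofNat _ 48).symm, ← map_mul]
      norm_num
    have h2 := PowerSeries.inv_mul_cancel _ hc
    calc _ = (C (1 / 48 : ℝ) * 48) *
        ((1 + 3 * X - C m₄ * X : ℝ⟦X⟧)⁻¹ * (1 + 3 * X - C m₄ * X)) ^ 15 := by ring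
      _ = 1 := by rw [h1, h2]; simp
  ext n
  rw [coeff_crossFun, hinv, PowerSeries.coeff_mul]
  set Q : ℝ⟦X⟧ := C (1 / 48) * (1 + 3 * X - C m₄ * X : ℝ⟦X⟧)⁻¹ ^ 15
  -- The truncation in `summandSum` depends on the coefficient; all ranges are enlarged to `n + 1`,
  -- which adds only zeros.
  have h1 : ∑ p ∈ Finset.HasAntidiagonal.antidiagonal n, coeff p.1 Q * coeff p.2 (summandSum m₄) =
      ∑ i ∈ Finset.range (n + 1), coeff n (Q * summand m₄ i) := by
    simp only [PowerSeries.coeff_mul]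
    rw [Finset.sum_comm]
    refine Finset.sum_congr rfl fun p hp => ?_
    rw [← Finset.mul_sum, summandSum, PowerSeries.coeff_mk]
    congr 1
    have hp2 : p.2 ≤ n := by rw [Finset.HasAntidiagonal.mem_antidiagonal] at hp; omega
    refine Finset.sum_subset (Finset.range_mono (by omega)) fun i _ hi => ?_
    exact coeff_summand_eq_zero m₄ (by simpa using hi)
  rw [h1, ← Finset.Nat.sum_antidiagonal_swap,
    Finset.Nat.sum_antidiagonal_eq_sum_range_succ_mk]
  refine Finset.sum_congr rfl fun i hi => ?_
  have hin : i ≤ n := by simpa [Nat.lt_succ_iff] using hi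
  have h2 : Q * summand m₄ i = C (1 / 48 * ((1 + i) * (2 + i) * ((4 + i).factorial : ℝ))) *
      (X ^ i * (1 + 3 * X - C m₄ * X : ℝ⟦X⟧)⁻¹ ^ (14 + 3 * i + 1)) := by
    rw [summand, map_mul (C (R := ℝ)) (1 / 48)]
    simp only [Q]
    ring
  rw [h2, PowerSeries.coeff_C_mul, PowerSeries.coeff_X_pow_mul', if_pos hin,
    coeff_inv_linear_pow]
  simp only [Prod.swap]
  ring

theorem genFun_tableSum_eq (m : ℕ → ℝ) (h0 : m 0 = 1) (h1 : m 1 = 0) (h2 : m 2 = 1) :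
    genFun (tableSum m) = (1 + C (m 3 ^ 2) * X) ^ 10 *
      (rescale (m 6 - 10 * m 3 ^ 2 - 15 * m 4 + 30) (exp ℝ) * crossFun (m 4 - 3)) := by
  rw [genFun_tableSum m h0 h1 h2, genFun_rowPoly]

/-! ### Even tables. -/

/-- Replacing the odd moments by zero kills exactly the tables that are not even and leaves the
weights of even ones unchanged. -/
theorem evenTableSum_eq_tableSum (m : ℕ → ℝ) :
    evenTableSum m 6 = tableSum fun j => if Even j then m j else 0 := by
  classical
  funext n
  rw [evenTableSum, tableSum, Finset.sum_filter]
  refine Finset.sum_congr rfl fun T _ => ?_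
  split_ifs with h
  · congr 1
    refine Finset.prod_congr rfl fun p _ => Finset.prod_congr rfl fun v _ => ?_
    simp only [if_pos (h p v)]
  · simp only [Table.IsEven, not_forall] at h
    obtain ⟨p, v, h⟩ := h
    rw [Table.weight, Finset.prod_eq_zero (Finset.mem_univ p), mul_zero]
    exact Finset.prod_eq_zero (Finset.mem_univ v) (if_neg h)

/-- Passing to even tables sets `m 3` to zero in the closed form: the tenth power becomes 1 and the
exponent changes by `10 * m 3 ^ 2`. -/
theorem genFun_tableSum_eq_evenTableSum (m : ℕ → ℝ) (h0 : m 0 = 1) (h1 : m 1 = 0)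
    (h2 : m 2 = 1) :
    genFun (tableSum m) = (1 + C (m 3 ^ 2) * X) ^ 10 * rescale (-10 * m 3 ^ 2) (exp ℝ) *
      genFun (evenTableSum m 6) := by
  have h4 : Even 4 := by decide
  have h6 : Even 6 := by decide
  have h3 : ¬ Even 3 := by decide
  rw [genFun_tableSum_eq m h0 h1 h2, evenTableSum_eq_tableSum, genFun_tableSum_eq _ (by simp [h0])
    (by simp) (by simp [h2])]
  simp only [h3, h4, h6, if_true, if_false]
  have hexp := PowerSeries.exp_mul_exp_eq_exp_add (A := ℝ) (-10 * m 3 ^ 2)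
    (m 6 - 10 * 0 ^ 2 - 15 * m 4 + 30)
  rw [show m 6 - 10 * m 3 ^ 2 - 15 * m 4 + 30 =
    -10 * m 3 ^ 2 + (m 6 - 10 * 0 ^ 2 - 15 * m 4 + 30) by ring, ← hexp]
  simp
  ring

/-! ### Expectation of the sixth power of the determinant. -/

theorem integrable_pow_of_le (μ : Measure ℝ) [IsProbabilityMeasure μ]
    (h6 : Integrable (fun x : ℝ => x ^ 6) μ) {k : ℕ} (hk : k ≤ 6) :
    Integrable (fun x : ℝ => x ^ k) μ := by
  refine Integrable.mono' ((integrable_const (1 : ℝ)).add h6)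
    (measurable_id.pow_const k).aestronglyMeasurable (Filter.Eventually.of_forall fun x => ?_)
  rw [Real.norm_eq_abs, abs_pow, Pi.add_apply, ← Even.pow_abs (by decide : Even 6) x]
  rcases le_total |x| 1 with h | h
  · have h1 : |x| ^ k ≤ 1 := pow_le_one₀ (abs_nonneg x) h
    have h2 : 0 ≤ |x| ^ 6 := by positivity
    linarith
  · have h1 : |x| ^ k ≤ |x| ^ 6 := pow_le_pow_right₀ h hk
    linarith

theorem Table.count_le {n : ℕ} (T : Table 6 n) (p v : Fin n) : T.count p v ≤ 6 := by
  have := Finset.card_le_univ (Finset.univ.filter fun q : Fin 6 => T q p = v)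
  simpa [Table.count] using this

/-- Each table row is one permutation of the Leibniz expansion; positions index matrix columns and
numbers index matrix rows, so equal entries are collected by `Table.count`. -/
theorem det_pow_six {n : ℕ} (M : Fin n → Fin n → ℝ) : (Matrix.of M).det ^ 6 =
    ∑ T : Table 6 n, T.sgn * ∏ v, ∏ p, M v p ^ T.count p v := by
  have h := Finset.prod_univ_sum (fun _ : Fin 6 => (Finset.univ : Finset (Equiv.Perm (Fin n))))
    (fun _ σ => ((Equiv.Perm.sign σ : ℤ) : ℝ) * ∏ i, Matrix.of M (σ i) i)
  rw [Finset.prod_const, Finset.card_univ, Fintype.card_fin, Fintype.piFinset_univ] at h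
  rw [Matrix.det_apply', h]
  refine Finset.sum_congr rfl fun T _ => ?_
  rw [Finset.prod_mul_distrib, Table.sgn, Finset.prod_comm, Finset.prod_comm (s := Finset.univ)
    (t := Finset.univ) (f := fun v p => M v p ^ Table.count T p v)]
  congr 1
  refine Finset.prod_congr rfl fun p _ => ?_
  refine (Finset.prod_fiberwise' Finset.univ (fun q => T q p) fun v => M v p).symm.trans ?_
  exact Finset.prod_congr rfl fun v _ => Finset.prod_const _

theorem integrable_prod_pow (μ : Measure ℝ) [IsProbabilityMeasure μ]
    (h6 : Integrable (fun x : ℝ => x ^ 6) μ) {n : ℕ} (T : Table 6 n) :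
    Integrable (fun M : Fin n → Fin n → ℝ => ∏ v, ∏ p, M v p ^ T.count p v) (iidMatrix μ n) :=
  Integrable.fintype_prod_dep (f := fun v (x : Fin n → ℝ) => ∏ p, x p ^ T.count p v) fun v =>
    Integrable.fintype_prod_dep (f := fun p (x : ℝ) => x ^ T.count p v) fun p =>
      integrable_pow_of_le μ h6 (T.count_le p v)

theorem integrable_det_pow_six (μ : Measure ℝ) [IsProbabilityMeasure μ]
    (h6 : Integrable (fun x : ℝ => x ^ 6) μ) (n : ℕ) :
    Integrable (fun M : Fin n → Fin n → ℝ => (Matrix.of M).det ^ 6) (iidMatrix μ n) := by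
  simp only [det_pow_six]
  exact integrable_finsetSum _ fun T _ => (integrable_prod_pow μ h6 T).const_mul _

theorem detMoment_eq_tableSum (μ : Measure ℝ) [IsProbabilityMeasure μ]
    (h6 : Integrable (fun x : ℝ => x ^ 6) μ) :
    detMoment μ 6 = tableSum fun j => moment id j μ := by
  funext n
  simp only [detMoment, det_pow_six]
  rw [integral_finsetSum _ fun T _ => (integrable_prod_pow μ h6 T).const_mul _, tableSum]
  refine Finset.sum_congr rfl fun T _ => ?_
  rw [integral_const_mul, iidMatrix, integral_fintype_prod_eq_prod
    (f := fun v (x : Fin n → ℝ) => ∏ p, x p ^ T.count p v), Table.weight, Finset.prod_comm]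
  congr 1
  refine Finset.prod_congr rfl fun v _ => ?_
  rw [integral_fintype_prod_eq_prod (f := fun p (x : ℝ) => x ^ T.count p v)]
  rfl

end SixthMoment
end

theorem theorem2 (μ : Measure ℝ) [IsProbabilityMeasure μ]
    (h6 : Integrable (fun x : ℝ => x ^ 6) μ)
    (hm1 : moment id 1 μ = 0) (hm2 : moment id 2 μ = 1)
    (m₃ m₄ m₆ : ℝ) (hm3 : m₃ = moment id 3 μ) (hm4 : m₄ = moment id 4 μ)
    (hm6 : m₆ = moment id 6 μ) :
    (∀ n : ℕ, Integrable (fun M : Fin n → Fin n → ℝ => (Matrix.of M).det ^ 6)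
      (SixthMoment.iidMatrix μ n)) ∧
    SixthMoment.genFun (SixthMoment.detMoment μ 6) =
      (1 + C (m₃ ^ 2) * X) ^ 10 *
        (rescale (m₆ - 10 * m₃ ^ 2 - 15 * m₄ + 30) (exp ℝ) *
          (48 * (1 + 3 * X - C m₄ * X) ^ 15)⁻¹) *
        SixthMoment.summandSum m₄ ∧
    SixthMoment.genFun (SixthMoment.detMoment μ 6) =
      (1 + C (m₃ ^ 2) * X) ^ 10 * rescale (-10 * m₃ ^ 2) (exp ℝ) *
        SixthMoment.genFun (SixthMoment.evenTableSum (fun j => moment id j μ) 6) := by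
  have hm0 : moment id 0 μ = 1 := by simp [moment]
  refine ⟨SixthMoment.integrable_det_pow_six μ h6, ?_, ?_⟩
  · rw [SixthMoment.detMoment_eq_tableSum μ h6,
      SixthMoment.genFun_tableSum_eq (fun j => moment id j μ) hm0 hm1 hm2, ← hm3, ← hm4, ← hm6,
      SixthMoment.crossFun_eq]
    ring
  · rw [SixthMoment.detMoment_eq_tableSum μ h6, SixthMoment.genFun_tableSum_eq_evenTableSum
      (fun j => moment id j μ) hm0 hm1 hm2, ← hm3]
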